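/- Let $\mathcal S$ be a closed connected oriented surface of genus $g\ge 2$ and let $\tau$ be a hexagonal tessellation of $\mathcal S$ such that: the sides of each hexagonal tile are coloured alternately red and blue, the tiles are glued pairwise along edges of the same colour, and every vertex has valence four. At each vertex the two red edges are opposite to each other, and so are the two blue edges; hence the graph of red edges is a disjoint union of cycles, called the red curves of $\tau$, and the graph of blue edges is a disjoint union of cycles, called the blue curves of $\tau$. Let $k\ge 3$ and assume that $\tau$ is $k$-regular, i.e. that each curve of $\tau$, red or blue, consists of exactly $k$ edges. Let $S_\tau(\pi/2)$ be the closed hyperbolic surface obtained by making each tile isometric to the regular right-angled hexagon of the hyperbolic plane (with side length $\operatorname{arcosh} 2$), the tiles being glued by isometries along their edges. A systole of this surface is an essential (that is, non-null-homotopic) closed geodesic of minimal length. Assume that the set of systoles of $S_\tau(\pi/2)$ is exactly the set of the curves (red and blue) of $\tau$. Then $\tau$ satisfies the following two axioms. (AX4) A blue edge and a red curve meet at most once (i.e. in at most one point). (AX5) Two distinct blue edges are adjacent on the same side of at most one red curve. Here two blue edges are adjacent on the same side of a red curve $R$ if each has an endpoint on $R$ at which it enters the same one of the two annuli into which $R$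 divides a small regular neighbourhood of $R$. -/

import Mathlib

open scoped UpperHalfPlane ENNReal

noncomputable section

/-! ### Closed geodesics and systoles of a metric space -/

namespace MetricSystole

variable {X : Type*} [PseudoEMetricSpace X]

/-- The length of a closed curve. -/
def length {x : X} (γ : Path x x) : ℝ≥0∞ := eVariationOn γ Set.univ

/-- A closed curve is essential if it cannot be contracted to a point. -/
def IsEssential {x : X} (γ : Path x x) : Prop := ¬ γ.Homotopic (Path.refl x)

/-- A closed curve is a closed geodesic (parametrized with constant speed `v > 0`) if its
`1`-periodic extension to the real line is, up to the factor `v`, locally isometric. -/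
def IsClosedGeodesic {x : X} (γ : Path x x) : Prop :=
  ∃ v : ℝ, 0 < v ∧ ∀ t : ℝ, ∃ ε : ℝ, 0 < ε ∧ ∀ s s' : ℝ, |s - t| < ε → |s' - t| < ε →
    edist (γ.extend (Int.fract s)) (γ.extend (Int.fract s')) = ENNReal.ofReal (v * |s - s'|)

/-- A systole is an essential closed geodesic of minimal length, i.e. one that is not longer
than any essential closed curve. -/
def IsSystole {x : X} (γ : Path x x) : Prop :=
  IsClosedGeodesic γ ∧ IsEssential γ ∧
    ∀ (y : X) (δ : Path y y), IsEssential δ → length γ ≤ length δ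

variable (X) in
/-- The set of systoles of `X`, a systole being regarded as an unparametrized, unoriented curve,
that is, as a subset of `X`. -/
def systoles : Set (Set X) := {C | ∃ (x : X) (γ : Path x x), IsSystole γ ∧ C = Set.range γ}

end MetricSystole

/-! ### The regular right-angled hexagon in the hyperbolic plane -/

namespace Hexagon

/-- The geodesic segment between two points of the hyperbolic plane. -/
def seg (a b : ℍ) : Set ℍ := {z | dist a z + dist z b = dist a b}

/-- The matrix of the hyperbolic rotation about `i` by the angle `θ`. -/
def rotation (θ : ℝ) : Matrix.SpecialLinearGroup (Fin 2) ℝ :=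
  ⟨!![Real.cos (θ / 2), Real.sin (θ / 2); -Real.sin (θ / 2), Real.cos (θ / 2)], by
    rw [Matrix.det_fin_two_of]
    nlinarith [Real.sin_sq_add_cos_sq (θ / 2)]⟩

/-- The point of the imaginary axis at distance `arcosh √3 = log (√3 + √2)` above `i`; this
distance is the circumradius of the regular right-angled hexagon. -/
def topVertex : ℍ :=
  ⟨⟨0, Real.sqrt 3 + Real.sqrt 2⟩, by
    have h3 : 0 < Real.sqrt 3 := Real.sqrt_pos.2 (by norm_num)
    have h2 : 0 ≤ Real.sqrt 2 := Real.sqrt_nonneg 2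
    change 0 < Real.sqrt 3 + Real.sqrt 2
    linarith⟩

/-- The `j`-th vertex of the regular right-angled hexagon centred at `i`. -/
def vertex (j : ZMod 6) : ℍ := rotation (j.val * (Real.pi / 3)) • topVertex

/-- The `j`-th side, going from the `j`-th to the `(j+1)`-st vertex. -/
def side (j : ZMod 6) : Set ℍ := seg (vertex j) (vertex (j + 1))

/-- The closed hexagon: the union of the segments from the centre to the points of the sides. -/
def region : Set ℍ := {z | ∃ j : ZMod 6, ∃ p ∈ side j, z ∈ seg UpperHalfPlane.I p}

end Hexagon

/-! ### Hexagonal tessellations -/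

/-- A tessellation of a closed connected oriented surface by hexagons with sides coloured
alternately red and blue, the tiles being glued pairwise along edges of the same colour, all
vertices having valence four. Here `F` is the set of tiles. The sides of a tile are numbered by
`ZMod 6` in the cyclic order given by the orientation, so that `(f, i)` is the `i`-th side of the
tile `f`; it runs from the `i`-th to the `(i+1)`-st corner of `f`. Even sides are red, odd sides
are blue. The side `d` is glued to the side `glue d`, with reversed direction. -/
structure HexTessellation (F : Type*) where
  glue : F × ZMod 6 → F × ZMod 6
  glue_involutive : Function.Involutive glue
  glue_ne : ∀ d, glue d ≠ d
  glue_colour : ∀ d, Even (glue d).2 ↔ Even d.2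
  /-- `d ↦ glue (d.1, d.2 - 1)` is the rotation about the starting vertex of the side `d`. -/
  valence_four : ∀ d, Function.minimalPeriod (fun e : F × ZMod 6 => glue (e.1, e.2 - 1)) d = 4
  connected : ∀ f f' : F,
    Relation.ReflTransGen (fun a b => ∃ i j : ZMod 6, glue (a, i) = (b, j)) f f'

namespace HexTessellation

variable {F : Type*} (T : HexTessellation F)

/-- The next side of the same tile. -/
def next (d : F × ZMod 6) : F × ZMod 6 := (d.1, d.2 + 1)

/-- The continuation of the oriented edge `d` beyond its final vertex: the edge which is opposite
to `d` at this vertex. It is a side of the tile that lies on the same side of the curve. -/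
def straight (d : F × ZMod 6) : F × ZMod 6 := next (T.glue (next d))

/-- The edge of the tessellation to which the side `d` belongs. -/
def edge (d : F × ZMod 6) : Sym2 (F × ZMod 6) := s(d, T.glue d)

/-- The edges of the curve of the tessellation that contains the edge of `d`. -/
def curveEdges (d : F × ZMod 6) : Set (Sym2 (F × ZMod 6)) :=
  Set.range fun n : ℕ => T.edge (T.straight^[n] d)

/-- `k`-regularity: each curve, red or blue, consists of exactly `k` edges. -/
def IsRegular (k : ℕ) : Prop := ∀ d, (T.curveEdges d).ncard = k

/-! #### The hyperbolic surface obtained from regular right-angled hexagonal tiles -/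

/-- Elementary identification: a point `p` of the side `(f, i)` is identified with the point `q` of
the side `glue (f, i) = (f', j)` whose distance to the end of that side is the distance of `p` to
the start of `(f, i)`. -/
def Glued (x y : F × Hexagon.region) : Prop :=
  ∃ i j : ZMod 6, T.glue (x.1, i) = (y.1, j) ∧
    (x.2 : ℍ) ∈ Hexagon.side i ∧ (y.2 : ℍ) ∈ Hexagon.side j ∧
    dist (Hexagon.vertex i) (x.2 : ℍ) = dist (Hexagon.vertex (j + 1)) (y.2 : ℍ)

/-- The surface obtained by gluing copies of the regular right-angled hexagon, one for each tile.
It carries the gluing metric defined below, and the topology of this metric. -/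
def Surface : Type _ := Quot T.Glued

/-- The point of the surface given by the point `p` of the tile `f`. -/
def point (f : F) (p : Hexagon.region) : T.Surface := Quot.mk T.Glued (f, p)

/-- The hyperbolic distance of two points inside a common tile (`∞` if there is no such tile). -/
def tileDist (x y : T.Surface) : ℝ≥0∞ :=
  ⨅ (f : F) (p : Hexagon.region) (q : Hexagon.region) (_ : T.point f p = x) (_ : T.point f q = y),
    edist (p : ℍ) (q : ℍ)

theorem tileDist_self (x : T.Surface) : T.tileDist x x = 0 := by
  obtain ⟨⟨f, p⟩, rfl⟩ := Quot.exists_rep x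
  refine nonpos_iff_eq_zero.1 ?_
  refine (iInf_le_of_le f <| iInf_le_of_le p <| iInf_le_of_le p <| iInf_le_of_le rfl <|
    iInf_le_of_le rfl ?_)
  simp

theorem tileDist_le (x y : T.Surface) : T.tileDist x y ≤ T.tileDist y x := by
  refine le_iInf fun f => le_iInf fun p => le_iInf fun q => le_iInf fun hp => le_iInf fun hq => ?_
  refine iInf_le_of_le f <| iInf_le_of_le q <| iInf_le_of_le p <| iInf_le_of_le hq <|
    iInf_le_of_le hp ?_
  rw [edist_comm]

theorem tileDist_comm (x y : T.Surface) : T.tileDist x y = T.tileDist y x :=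
  le_antisymm (T.tileDist_le x y) (T.tileDist_le y x)

/-- The gluing metric: the distance of `x` and `y` is the infimum of the lengths of the chains from
`x` to `y` whose successive points lie in a common tile. This is the length metric of the hyperbolic
structure on the surface. -/
instance : PseudoEMetricSpace T.Surface where
  edist x y := ⨅ l : List T.Surface, (List.zipWith T.tileDist (x :: l) (l ++ [y])).sum
  edist_self x := nonpos_iff_eq_zero.1 <| (iInf_le _ []).trans_eq <| by simp [tileDist_self]
  edist_comm x y := by
    refine List.reverse_surjective.iInf_congr _ fun l => ?_
    rw [← List.sum_reverse, List.reverse_zipWith, List.reverse_append, List.reverse_reverse,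
      List.reverse_singleton, List.singleton_append, List.reverse_cons, List.reverse_reverse,
      List.zipWith_comm_of_comm T.tileDist_comm]
    simp only [List.length, List.length_append]
  edist_triangle x y z := by
    refine ENNReal.le_iInf_add_iInf fun lxy lyz => ?_
    calc
      ⨅ l, (List.zipWith T.tileDist (x :: l) (l ++ [z])).sum ≤
          (List.zipWith T.tileDist (x :: lxy ++ y :: lyz) ((lxy ++ y :: lyz) ++ [z])).sum :=
        iInf_le _ (lxy ++ y :: lyz)
      _ = (List.zipWith T.tileDist (x :: lxy) (lxy ++ [y])).sum +
          (List.zipWith T.tileDist (y :: lyz) (lyz ++ [z])).sum := by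
        rw [← List.sum_append, ← List.zipWith_append, List.cons_append,
          ← @List.singleton_append _ y, List.append_assoc, List.append_assoc, List.append_assoc]
        rw [List.length_cons, List.length_append, List.length_singleton]

/-- The closed edge of `d`, as a subset of the surface. -/
def edgeSet (d : F × ZMod 6) : Set T.Surface :=
  {x | ∃ p : Hexagon.region, (p : ℍ) ∈ Hexagon.side d.2 ∧ T.point d.1 p = x}

/-- The curve of the tessellation through the edge of `d`, as a subset of the surface. -/
def curveSet (d : F × ZMod 6) : Set T.Surface := ⋃ n : ℕ, T.edgeSet (T.straight^[n] d)

/-- The set of all curves of the tessellation, red or blue. -/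
def curves : Set (Set T.Surface) := Set.range T.curveSet

/-! #### The two additional axioms -/

/-- A blue edge and a red curve meet at most once. -/
def AX4 : Prop :=
  ∀ b r : F × ZMod 6, ¬ Even b.2 → Even r.2 → (T.edgeSet b ∩ T.curveSet r).Subsingleton

/-- The edge of `b` is adjacent to the curve of `r` on that side of the curve on which the tile of
`r` lies. (The tiles that touch the curve along an edge on this side are those of the sides
`straight^[n] r`; the other side of the curve is the one given by `glue r`.) -/
def AdjacentOnSide (b r : F × ZMod 6) : Prop :=
  ∃ n : ℕ, T.edge (next (T.straight^[n] r)) = T.edge b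

/-- Two distinct blue edges are adjacent on the same side of at most one red curve. -/
def AX5 : Prop :=
  ∀ b b' : F × ZMod 6, ¬ Even b.2 → ¬ Even b'.2 → T.edge b ≠ T.edge b' →
    ∀ r r' : F × ZMod 6, Even r.2 → Even r'.2 →
      (T.AdjacentOnSide b r ∧ T.AdjacentOnSide b' r) →
      (T.AdjacentOnSide b r' ∧ T.AdjacentOnSide b' r') →
      T.curveSet r = T.curveSet r'

end HexTessellation

end

/-! ### Linear coordinates of the hyperbolic plane -/

namespace Hexagon

/-! Let ℓ = arcosh 2 be the side length. A closed path tracing a curve of the tessellation has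
length at least kℓ (`le_length_of_range_eq`). As the curves are systoles, every closed path shorter
than kℓ is null-homotopic. Violations of the axioms produce closed walks shorter than kℓ whose
developments in the hyperbolic plane do not close up, which is a contradiction.

To make this precise without constructing a universal cover, the tiles are placed in the hyperbolic
plane by all possible isometries, and placed tiles are glued when they fit together. The resulting
space `Dev` has a projection to the surface and a developing map to the plane. Balls project onto
balls (`exists_lift`), and small balls project injectively (`eq_of_edist_lt`), because four right
angles fill the plane around a vertex. Hence a path in `Dev` over a null-homotopic closed curve is
closed (`eq_of_homotopic_refl`). Together with the length bound this gives `develop_eq_of_reach`: a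
path in `Dev` of length less than kℓ whose ends have the same projection has ends with the same
development.

AX4. If both ends of a blue edge lie on one red curve, the edge and one of the two arcs between its
ends form a closed walk of fewer than k edges; here k ≥ 3 is needed. In the plane the arc stays on a
geodesic, while the edge leaves it perpendicularly (`corner_ne_of_blue`).

AX5. If two blue edges join two red curves on the same sides, suitable arcs of m and m' edges with m
+ m' ≤ k complete them to a rectangle. Its boundary has m + m' + 2 edges, which may be too many. At
each blue edge, however, the walk red, blue, red along a tile can be replaced by the way through the
centre of the tile, of length 2 arcosh √3 < 2ℓ. For m, m' ≥ 2 the shortened walk has length less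
than kℓ. It cannot close up because a hyperbolic quadrilateral does not have four right angles; this
is `sideForm_translation_pow_pos` and `not_rectangle`. If m or m' is 1, the rectangle degenerates to
a bigon as in AX4, or is impossible inside one hexagon.

All hyperbolic geometry is done in the hyperboloid model, where isometries act linearly and the
claims become polynomial identities in √2 and √3. -/

/-- The first of three coordinates that embed the hyperbolic plane as a sheet of the
hyperboloid `P * R - Q ^ 2 = 1`, on which `SL(2, ℝ)` acts linearly. -/
noncomputable def coordP (z : ℍ) : ℝ := (z.re ^ 2 + z.im ^ 2) / z.im

/-- The second coordinate of the hyperboloid model. -/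
noncomputable def coordQ (z : ℍ) : ℝ := z.re / z.im

/-- The third coordinate of the hyperboloid model. -/
noncomputable def coordR (z : ℍ) : ℝ := 1 / z.im

theorem coordR_pos (z : ℍ) : 0 < coordR z := one_div_pos.2 z.im_pos

theorem coord_quadric (z : ℍ) : coordP z * coordR z - coordQ z ^ 2 = 1 := by
  have := z.im_pos.ne'
  simp only [coordP, coordQ, coordR]
  field_simp
  ring

theorem coordP_pos (z : ℍ) : 0 < coordP z := by
  have h1 := coord_quadric z
  have h2 := coordR_pos z
  by_contra h
  nlinarith [sq_nonneg (coordQ z), mul_nonneg (sub_nonneg.2 (not_lt.1 h)) h2.le]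

theorem cosh_dist_eq_coord (z w : ℍ) : Real.cosh (dist z w) =
    (coordP z * coordR w + coordR z * coordP w - 2 * (coordQ z * coordQ w)) / 2 := by
  have hz := z.im_pos.ne'
  have hw := w.im_pos.ne'
  rw [UpperHalfPlane.cosh_dist, Complex.dist_eq_re_im, Real.sq_sqrt (by positivity)]
  simp only [coordP, coordQ, coordR, UpperHalfPlane.coe_re, UpperHalfPlane.coe_im]
  field_simp
  ring

/-- The coordinates are the entries of a symmetric matrix X of determinant 1 with diagonal P, R and
off-diagonal Q, and M acts by X ↦ M X Mᵀ. -/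
theorem coord_smul (M : Matrix.SpecialLinearGroup (Fin 2) ℝ) (z : ℍ) :
    coordP (M • z) = M 0 0 ^ 2 * coordP z + 2 * M 0 0 * M 0 1 * coordQ z + M 0 1 ^ 2 * coordR z ∧
    coordQ (M • z) = M 0 0 * M 1 0 * coordP z + (M 0 0 * M 1 1 + M 0 1 * M 1 0) * coordQ z
      + M 0 1 * M 1 1 * coordR z ∧
    coordR (M • z) = M 1 0 ^ 2 * coordP z + 2 * M 1 0 * M 1 1 * coordQ z + M 1 1 ^ 2 * coordR z := by
  have hdet : M 0 0 * M 1 1 - M 0 1 * M 1 0 = 1 := by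
    have := M.det_coe
    rwa [Matrix.det_fin_two] at this
  set a := M 0 0
  set b := M 0 1
  set c := M 1 0
  set d := M 1 1
  have hy := z.im_pos
  have hc := UpperHalfPlane.coe_specialLinearGroup_apply M z
  have hD : 0 < (c * z.re + d) ^ 2 + (c * z.im) ^ 2 := by
    by_contra h
    have h1 : (c * z.re + d) = 0 := by nlinarith [sq_nonneg (c * z.re + d), sq_nonneg (c * z.im)]
    have h2 : (c * z.im) = 0 := by nlinarith [sq_nonneg (c * z.re + d), sq_nonneg (c * z.im)]
    have h3 : c = 0 := by simpa [hy.ne'] using h2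
    have h4 : d = 0 := by simpa [h3] using h1
    simp [h3, h4] at hdet
  have hre : (M • z).re = ((a * z.re + b) * (c * z.re + d) + a * c * z.im ^ 2) /
      ((c * z.re + d) ^ 2 + (c * z.im) ^ 2) := by
    rw [← UpperHalfPlane.coe_re, hc]
    simp [Complex.div_re, Complex.normSq_apply]
    simp only [← pow_two, ← add_div]
    simp only [a, b, c, d]
    congr 1
    ring
  have him : (M • z).im = z.im / ((c * z.re + d) ^ 2 + (c * z.im) ^ 2) := by
    rw [← UpperHalfPlane.coe_im, hc]
    simp [Complex.div_im, Complex.normSq_apply]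
    simp only [← pow_two, ← sub_div]
    simp only [a, b, c, d] at hdet ⊢
    congr 1
    linear_combination z.im * hdet
  have hQ : coordQ (M • z) = a * c * coordP z + (a * d + b * c) * coordQ z + b * d * coordR z := by
    simp only [coordP, coordQ, coordR, hre, him]
    rw [div_div_div_cancel_right₀ hD.ne']
    field_simp
    ring
  have hR : coordR (M • z) = c ^ 2 * coordP z + 2 * c * d * coordQ z + d ^ 2 * coordR z := by
    simp only [coordP, coordQ, coordR, him]
    field_simp
    ring
  -- The first coordinate follows from the other two through the quadric.
  refine ⟨mul_right_cancel₀ (coordR_pos (M • z)).ne' ?_, hQ, hR⟩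
  have h1 : coordP (M • z) * coordR (M • z) = 1 + coordQ (M • z) ^ 2 := by
    linarith [coord_quadric (M • z)]
  rw [h1, hQ, hR]
  linear_combination (-(a * d - b * c) ^ 2) * coord_quadric z - (a * d - b * c + 1) * hdet

/-- A vector orthogonal to a point of the hyperboloid and of norm zero vanishes. -/
theorem eq_zero_of_orthogonal (z : ℍ) {p q r : ℝ}
    (h1 : coordP z * r + coordR z * p - 2 * (coordQ z * q) = 0) (h2 : p * r - q ^ 2 = 0) :
    p = 0 ∧ q = 0 ∧ r = 0 := by
  have hz := coord_quadric z
  have hR := coordR_pos z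
  have hP := coordP_pos z
  have hq : q = 0 := by
    -- This identity exhibits that the form is definite on the orthogonal complement of a point of
    -- the hyperboloid.
    have : (coordR z * p - coordP z * r) ^ 2 = -4 * q ^ 2 := by
      linear_combination (coordP z * r + coordR z * p + 2 * (coordQ z * q)) * h1
        - 4 * coordP z * coordR z * h2 - 4 * q ^ 2 * hz
    nlinarith [sq_nonneg (coordR z * p - coordP z * r), sq_nonneg q]
  subst hq
  have h3 : p * r = 0 := by linarith
  rcases mul_eq_zero.1 h3 with h | h
  · subst h
    simp [hP.ne'] at h1
    simp [h1]
  · subst h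
    simp [hR.ne'] at h1
    simp [h1]

/-- Stewart's theorem in the hyperbolic plane. -/
theorem stewart {a b z : ℍ} (h : z ∈ seg a b) (w : ℍ) :
    Real.sinh (dist a b) * Real.cosh (dist w z) =
      Real.sinh (dist z b) * Real.cosh (dist w a) + Real.sinh (dist a z) * Real.cosh (dist w b) := by
  have h' : dist a b = dist a z + dist z b := h.symm
  have e1 := cosh_dist_eq_coord z a
  have e2 := cosh_dist_eq_coord z b
  have e3 := cosh_dist_eq_coord a b
  have hz := coord_quadric z
  have ha := coord_quadric a
  have hb := coord_quadric b
  rw [dist_comm z a] at e1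
  rw [h', Real.cosh_add] at e3
  have i1 := Real.cosh_sq (dist a z)
  have i2 := Real.cosh_sq (dist z b)
  rw [h', Real.sinh_add, cosh_dist_eq_coord w z, cosh_dist_eq_coord w a, cosh_dist_eq_coord w b]
  set x := dist a z
  set y := dist z b
  set sx := Real.sinh x
  set cx := Real.cosh x
  set sy := Real.sinh y
  set cy := Real.cosh y
  -- On a segment, sinh(ab)·z = sinh(zb)·a + sinh(az)·b as vectors: the difference is orthogonal to
  -- z and null. Pairing with w gives the claim.
  obtain ⟨k1, k2, k3⟩ := eq_zero_of_orthogonal z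
    (p := (sx * cy + cx * sy) * coordP z - sy * coordP a - sx * coordP b)
    (q := (sx * cy + cx * sy) * coordQ z - sy * coordQ a - sx * coordQ b)
    (r := (sx * cy + cx * sy) * coordR z - sy * coordR a - sx * coordR b)
    (by linear_combination 2 * (sx * cy + cx * sy) * hz + 2 * sy * e1 + 2 * sx * e2)
    (by linear_combination (sx * cy + cx * sy) ^ 2 * hz + sy ^ 2 * ha + sx ^ 2 * hb
          + 2 * (sx * cy + cx * sy) * sy * e1 + 2 * (sx * cy + cx * sy) * sx * e2
          - 2 * sx * sy * e3 - sy ^ 2 * i1 - sx ^ 2 * i2)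
  linear_combination coordP w / 2 * k3 + coordR w / 2 * k1 - coordQ w * k2

theorem seg_comm (a b : ℍ) : seg a b = seg b a := by
  ext z
  simp only [seg, Set.mem_ofPred_eq]
  rw [dist_comm a z, dist_comm z b, dist_comm a b, add_comm]

theorem left_mem_seg (a b : ℍ) : a ∈ seg a b := by simp [seg]

theorem right_mem_seg (a b : ℍ) : b ∈ seg a b := by simp [seg]

theorem map_mem_seg {a b z : ℍ} (g : ℍ ≃ᵢ ℍ) : g z ∈ seg (g a) (g b) ↔ z ∈ seg a b := by
  simp [seg, g.dist_eq]

/-- A point of a segment is determined by its distance to an end. -/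
theorem eq_of_mem_seg {a b z z' : ℍ} (h : z ∈ seg a b) (h' : z' ∈ seg a b)
    (hd : dist a z = dist a z') : z = z' := by
  have e1 : dist a z + dist z b = dist a b := h
  have e2 : dist a z' + dist z' b = dist a b := h'
  rcases (dist_nonneg (x := a) (y := b)).eq_or_lt with h0 | h0
  · have h3 : dist a z = 0 := by linarith [dist_nonneg (x := a) (y := z), dist_nonneg (x := z) (y := b)]
    have h4 : dist a z' = 0 := by linarith
    rw [← dist_eq_zero.1 h3, ← dist_eq_zero.1 h4]
  -- Stewart's theorem at the second point gives cosh of the distance equal to 1.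
  · have h3 := stewart h z'
    rw [dist_comm z' a, ← hd, show dist z' b = dist z b by linarith,
      show Real.sinh (dist z b) * Real.cosh (dist a z) + Real.sinh (dist a z) * Real.cosh (dist z b)
        = Real.sinh (dist a b) by rw [← e1, Real.sinh_add]; ring] at h3
    have h5 : Real.cosh (dist z' z) = 1 := by
      have := (Real.sinh_pos_iff.2 h0).ne'
      exact mul_left_cancel₀ this (by rw [h3, mul_one])
    have h6 : dist z' z = 0 := by
      by_contra hne
      exact (Real.one_lt_cosh.2 hne).ne' h5
    exact (dist_eq_zero.1 h6).symm

/-- The point of the hyperbolic plane with given coordinates. -/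
theorem exists_coord {p q r : ℝ} (hr : 0 < r) (h : p * r - q ^ 2 = 1) :
    ∃ z : ℍ, coordP z = p ∧ coordQ z = q ∧ coordR z = r := by
  refine ⟨⟨⟨q / r, 1 / r⟩, one_div_pos.2 hr⟩, ?_, ?_, ?_⟩
  · simp only [coordP, UpperHalfPlane.re, UpperHalfPlane.im]
    field_simp
    linarith
  · simp only [coordQ, UpperHalfPlane.re, UpperHalfPlane.im]
    field_simp
  · simp only [coordR, UpperHalfPlane.im]
    field_simp

theorem eq_of_cosh_dist_eq_one {z w : ℍ} (h : Real.cosh (dist z w) = 1) : z = w := by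
  refine dist_eq_zero.1 ?_
  by_contra hne
  exact (Real.one_lt_cosh.2 hne).ne' h

theorem eq_of_coord_eq {z w : ℍ} (h1 : coordP z = coordP w) (h2 : coordQ z = coordQ w)
    (h3 : coordR z = coordR w) : z = w := by
  refine eq_of_cosh_dist_eq_one ?_
  rw [cosh_dist_eq_coord, h1, h2, h3]
  linarith [coord_quadric w]

/-- Two points are joined by a geodesic. -/
theorem exists_geodesic (a b : ℍ) : ∃ c : ℝ → ℍ, c 0 = a ∧ c (dist a b) = b ∧
    (∀ s ∈ Set.Icc 0 (dist a b), ∀ t ∈ Set.Icc 0 (dist a b), dist (c s) (c t) = |s - t|) := by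
  rcases (dist_nonneg (x := a) (y := b)).eq_or_lt with h0 | h0
  · refine ⟨fun _ => a, rfl, dist_eq_zero.1 h0.symm, fun s hs t ht => ?_⟩
    rw [← h0] at hs ht
    have : s = 0 := le_antisymm hs.2 hs.1
    have : t = 0 := le_antisymm ht.2 ht.1
    simp [*]
  set l := dist a b with hl
  have hS : 0 < Real.sinh l := Real.sinh_pos_iff.2 h0
  have e := cosh_dist_eq_coord a b
  rw [← hl] at e
  have ha := coord_quadric a
  have hb := coord_quadric b
  have i1 := Real.cosh_sq l
  -- The point at distance t from a is the normalized combination of a and b with weights sinh(l -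
  -- t) and sinh t.
  have key : ∀ t ∈ Set.Icc 0 l, ∃ z : ℍ,
      coordP z = (Real.sinh (l - t) * coordP a + Real.sinh t * coordP b) / Real.sinh l ∧
      coordQ z = (Real.sinh (l - t) * coordQ a + Real.sinh t * coordQ b) / Real.sinh l ∧
      coordR z = (Real.sinh (l - t) * coordR a + Real.sinh t * coordR b) / Real.sinh l := by
    intro t ht
    have i2 := Real.cosh_sq t
    refine exists_coord ?_ ?_
    · have h1 : 0 ≤ Real.sinh (l - t) := Real.sinh_nonneg_iff.2 (sub_nonneg.2 ht.2)
      have h2 : 0 ≤ Real.sinh t := Real.sinh_nonneg_iff.2 ht.1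
      have h3 := coordR_pos a
      have h4 := coordR_pos b
      rcases ht.1.eq_or_lt with h | h
      · subst h
        simp only [sub_zero, Real.sinh_zero, zero_mul, add_zero]
        positivity
      · have h2 : 0 < Real.sinh t := Real.sinh_pos_iff.2 h
        positivity
    · field_simp
      rw [Real.sinh_sub]
      set C := Real.cosh l
      set S := Real.sinh l
      set u := Real.cosh t
      set v := Real.sinh t
      linear_combination (S * u - C * v) ^ 2 * ha + v ^ 2 * hb - 2 * (S * u - C * v) * v * e
        - v ^ 2 * i1 + S ^ 2 * i2
  have key' : ∀ t : ℝ, ∃ z : ℍ, t ∈ Set.Icc 0 l →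
      coordP z = (Real.sinh (l - t) * coordP a + Real.sinh t * coordP b) / Real.sinh l ∧
      coordQ z = (Real.sinh (l - t) * coordQ a + Real.sinh t * coordQ b) / Real.sinh l ∧
      coordR z = (Real.sinh (l - t) * coordR a + Real.sinh t * coordR b) / Real.sinh l := by
    intro t
    by_cases ht : t ∈ Set.Icc 0 l
    · obtain ⟨z, hz⟩ := key t ht
      exact ⟨z, fun _ => hz⟩
    · exact ⟨a, fun h => absurd h ht⟩
  choose c hc using key'
  have hdist : ∀ s ∈ Set.Icc 0 l, ∀ t ∈ Set.Icc 0 l, dist (c s) (c t) = |s - t| := by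
    intro s hs t ht
    obtain ⟨s1, s2, s3⟩ := hc s hs
    obtain ⟨t1, t2, t3⟩ := hc t ht
    have h1 : Real.cosh (dist (c s) (c t)) = Real.cosh (s - t) := by
      rw [cosh_dist_eq_coord, s1, s2, s3, t1, t2, t3]
      field_simp
      rw [Real.sinh_sub, Real.sinh_sub, Real.cosh_sub]
      set C := Real.cosh l
      set S := Real.sinh l
      linear_combination 2 * (S * Real.cosh s - C * Real.sinh s) * (S * Real.cosh t - C * Real.sinh t)
        * ha + 2 * Real.sinh s * Real.sinh t * hb
        - 2 * ((S * Real.cosh s - C * Real.sinh s) * Real.sinh t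
          + (S * Real.cosh t - C * Real.sinh t) * Real.sinh s) * e
        - 2 * Real.sinh s * Real.sinh t * i1
    rw [← abs_of_nonneg (dist_nonneg (x := c s) (y := c t))]
    exact le_antisymm (Real.cosh_le_cosh.1 h1.le) (Real.cosh_le_cosh.1 h1.ge)
  have hm0 : (0 : ℝ) ∈ Set.Icc 0 l := ⟨le_rfl, h0.le⟩
  have hml : l ∈ Set.Icc 0 l := ⟨h0.le, le_rfl⟩
  refine ⟨c, ?_, ?_, hdist⟩
  · obtain ⟨s1, s2, s3⟩ := hc 0 hm0
    apply eq_of_coord_eq <;> simp [s1, s2, s3, hS.ne']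
  · obtain ⟨s1, s2, s3⟩ := hc l hml
    apply eq_of_coord_eq <;> simp [s1, s2, s3, hS.ne']

/-- A segment contains a point at any prescribed distance to its start. -/
theorem exists_mem_seg {a b : ℍ} {t : ℝ} (ht : t ∈ Set.Icc 0 (dist a b)) :
    ∃ z ∈ seg a b, dist a z = t := by
  obtain ⟨c, h0, h1, hc⟩ := exists_geodesic a b
  have hm0 : (0 : ℝ) ∈ Set.Icc 0 (dist a b) := ⟨le_rfl, dist_nonneg⟩
  have hm1 : dist a b ∈ Set.Icc 0 (dist a b) := ⟨dist_nonneg, le_rfl⟩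
  have e1 : dist a (c t) = t := by
    conv_lhs => rw [← h0]
    rw [hc 0 hm0 t ht, zero_sub, abs_neg, abs_of_nonneg ht.1]
  have e2 : dist (c t) b = dist a b - t := by
    conv_lhs => rw [← h1]
    rw [hc t ht _ hm1, abs_sub_comm, abs_of_nonneg (sub_nonneg.2 ht.2)]
  exact ⟨c t, by simp [seg, e1, e2], e1⟩

end Hexagon

/-! ### The symmetries of the regular right-angled hexagon -/

namespace Hexagon

theorem rotation_mul (θ φ : ℝ) : rotation θ * rotation φ = rotation (θ + φ) := by
  have h : (θ + φ) / 2 = θ / 2 + φ / 2 := by ring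
  apply Subtype.ext
  change (rotation θ).1 * (rotation φ).1 = (rotation (θ + φ)).1
  simp only [rotation, h, Real.cos_add, Real.sin_add]
  ext i j
  fin_cases i <;> fin_cases j <;> simp [Matrix.mul_apply, Fin.sum_univ_two] <;> ring

theorem rotation_zero : rotation 0 = 1 := by
  apply Subtype.ext
  ext i j
  fin_cases i <;> fin_cases j <;> simp [rotation]

theorem rotation_pow (θ : ℝ) (n : ℕ) : rotation θ ^ n = rotation (n * θ) := by
  induction n with
  | zero => simp [rotation_zero]
  | succ n ih => rw [pow_succ, ih, rotation_mul]; congr 1; push_cast; ring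

/-- The matrix of the half turn about the midpoint of the side with number `0`. -/
noncomputable def halfTurnMatrix : Matrix.SpecialLinearGroup (Fin 2) ℝ :=
  -- The trace vanishes, so the square is minus the identity. The entries are such that the vertices
  -- 0 and 1 are interchanged.
  ⟨!![-1 / 2, -(√2 + √3 / 2); √2 - √3 / 2, 1 / 2], by
    rw [Matrix.det_fin_two_of]
    nlinarith [Real.sq_sqrt (show (0 : ℝ) ≤ 2 by norm_num),
      Real.sq_sqrt (show (0 : ℝ) ≤ 3 by norm_num)]⟩

/-- The rotation of the hexagon that carries each side to the next one. -/
noncomputable def turn : ℍ ≃ᵢ ℍ := IsometryEquiv.constSMul (rotation (Real.pi / 3))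

/-- The half turn about the midpoint of the side with number `0`. -/
noncomputable def halfTurn : ℍ ≃ᵢ ℍ := IsometryEquiv.constSMul halfTurnMatrix

theorem turn_apply (z : ℍ) : turn z = rotation (Real.pi / 3) • z := rfl

theorem halfTurn_apply (z : ℍ) : halfTurn z = halfTurnMatrix • z := rfl

theorem mul_apply (g g' : ℍ ≃ᵢ ℍ) (z : ℍ) : (g * g') z = g (g' z) := rfl

theorem one_apply (z : ℍ) : (1 : ℍ ≃ᵢ ℍ) z = z := rfl

theorem turn_pow_apply (n : ℕ) (z : ℍ) : (turn ^ n) z = rotation (n * (Real.pi / 3)) • z := by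
  rw [← rotation_pow]
  induction n with
  | zero => simp [one_apply]
  | succ n ih => rw [pow_succ', mul_apply, ih, turn_apply, pow_succ', mul_smul]

theorem coe_turnMatrix : (rotation (Real.pi / 3) : Matrix (Fin 2) (Fin 2) ℝ) =
    !![√3 / 2, 1 / 2; -1 / 2, √3 / 2] := by
  have h : Real.pi / 3 / 2 = Real.pi / 6 := by ring
  simp only [rotation, h, Real.cos_pi_div_six, Real.sin_pi_div_six]
  congr 1
  norm_num

theorem turn_coord (z : ℍ) :
    coordP (turn z) = 3 / 4 * coordP z + √3 / 2 * coordQ z + 1 / 4 * coordR z ∧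
    coordQ (turn z) = -√3 / 4 * coordP z + 1 / 2 * coordQ z + √3 / 4 * coordR z ∧
    coordR (turn z) = 1 / 4 * coordP z - √3 / 2 * coordQ z + 3 / 4 * coordR z := by
  have h3 : √3 * √3 = 3 := Real.mul_self_sqrt (by norm_num)
  obtain ⟨h1, h2, h4⟩ := coord_smul (rotation (Real.pi / 3)) z
  rw [turn_apply, h1, h2, h4, coe_turnMatrix]
  simp
  refine ⟨?_, ?_, ?_⟩
  · linear_combination 1 / 4 * coordP z * h3
  · linear_combination 1 / 4 * coordQ z * h3
  · linear_combination 1 / 4 * coordR z * h3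

theorem halfTurn_coord (z : ℍ) :
    coordP (halfTurn z) = 1 / 4 * coordP z + (√2 + √3 / 2) * coordQ z
      + (11 / 4 + √2 * √3) * coordR z ∧
    coordQ (halfTurn z) = (√3 / 4 - √2 / 2) * coordP z - 3 / 2 * coordQ z
      - (√2 / 2 + √3 / 4) * coordR z ∧
    coordR (halfTurn z) = (11 / 4 - √2 * √3) * coordP z + (√2 - √3 / 2) * coordQ z
      + 1 / 4 * coordR z := by
  have h3 : √3 * √3 = 3 := Real.mul_self_sqrt (by norm_num)
  have h2' : √2 * √2 = 2 := Real.mul_self_sqrt (by norm_num)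
  obtain ⟨h1, h2, h4⟩ := coord_smul halfTurnMatrix z
  rw [halfTurn_apply, h1, h2, h4]
  simp [halfTurnMatrix]
  refine ⟨?_, ?_, ?_⟩
  · linear_combination coordR z * h2' + 1 / 4 * coordR z * h3
  · linear_combination - coordQ z * h2' + 1 / 4 * coordQ z * h3
  · linear_combination coordP z * h2' + 1 / 4 * coordP z * h3

theorem coord_topVertex : coordP topVertex = √3 + √2 ∧ coordQ topVertex = 0 ∧
    coordR topVertex = √3 - √2 := by
  have h3 : √3 * √3 = 3 := Real.mul_self_sqrt (by norm_num)
  have h2 : √2 * √2 = 2 := Real.mul_self_sqrt (by norm_num)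
  have hpos : 0 < √3 + √2 := by positivity
  refine ⟨?_, ?_, ?_⟩
  · simp only [coordP, topVertex, UpperHalfPlane.re, UpperHalfPlane.im]
    field_simp
    ring
  · simp [coordQ, topVertex, UpperHalfPlane.re]
  · simp only [coordR, topVertex, UpperHalfPlane.im]
    field_simp
    linarith

theorem coord_I : coordP UpperHalfPlane.I = 1 ∧ coordQ UpperHalfPlane.I = 0 ∧
    coordR UpperHalfPlane.I = 1 := by
  simp [coordP, coordQ, coordR]

theorem turn_I : turn UpperHalfPlane.I = UpperHalfPlane.I := by
  obtain ⟨h1, h2, h3⟩ := turn_coord UpperHalfPlane.I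
  obtain ⟨k1, k2, k3⟩ := coord_I
  rw [k1, k2, k3] at h1 h2 h3
  apply eq_of_coord_eq
  · rw [h1, k1]; norm_num
  · rw [h2, k2]; ring
  · rw [h3, k3]; norm_num

theorem isometryEquiv_eq_of_coord {g g' : ℍ ≃ᵢ ℍ} (h : ∀ z, coordP (g z) = coordP (g' z) ∧
    coordQ (g z) = coordQ (g' z) ∧ coordR (g z) = coordR (g' z)) : g = g' := by
  ext1 z
  exact eq_of_coord_eq (h z).1 (h z).2.1 (h z).2.2

theorem turn_pow_three_coord (z : ℍ) : coordP ((turn ^ 3) z) = coordR z ∧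
    coordQ ((turn ^ 3) z) = -coordQ z ∧ coordR ((turn ^ 3) z) = coordP z := by
  have h3 : √3 * √3 = 3 := Real.mul_self_sqrt (by norm_num)
  have e : (turn ^ 3) z = turn (turn (turn z)) := rfl
  obtain ⟨a1, a2, a3⟩ := turn_coord z
  obtain ⟨b1, b2, b3⟩ := turn_coord (turn z)
  obtain ⟨c1, c2, c3⟩ := turn_coord (turn (turn z))
  rw [a1, a2, a3] at b1 b2 b3
  rw [b1, b2, b3] at c1 c2 c3
  rw [e, c1, c2, c3]
  refine ⟨?_, ?_, ?_⟩
  all_goals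
    clear * - h3
    generalize √3 = b at *
    grind

theorem turn_pow_six : turn ^ 6 = 1 := by
  refine isometryEquiv_eq_of_coord fun z => ?_
  have e : (turn ^ 6) z = (turn ^ 3) ((turn ^ 3) z) := by
    rw [← mul_apply, ← pow_add]
  obtain ⟨a1, a2, a3⟩ := turn_pow_three_coord z
  obtain ⟨b1, b2, b3⟩ := turn_pow_three_coord ((turn ^ 3) z)
  rw [e, one_apply, b1, b2, b3, a1, a2, a3]
  simp

theorem halfTurn_mul_self : halfTurn * halfTurn = 1 := by
  have h3 : √3 * √3 = 3 := Real.mul_self_sqrt (by norm_num)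
  have h2 : √2 * √2 = 2 := Real.mul_self_sqrt (by norm_num)
  refine isometryEquiv_eq_of_coord fun z => ?_
  obtain ⟨a1, a2, a3⟩ := halfTurn_coord z
  obtain ⟨b1, b2, b3⟩ := halfTurn_coord (halfTurn z)
  rw [mul_apply, one_apply, b1, b2, b3, a1, a2, a3]
  clear * - h2 h3
  generalize √3 = b at *
  generalize √2 = a at *
  refine ⟨?_, ?_, ?_⟩ <;> grind

/-- The quarter turn about the vertex with number `0`. -/
noncomputable def quarterTurn : ℍ ≃ᵢ ℍ := turn⁻¹ * halfTurn

theorem inv_turn_coord (z : ℍ) :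
    coordP (turn⁻¹ z) = 3 / 4 * coordP z - √3 / 2 * coordQ z + 1 / 4 * coordR z ∧
    coordQ (turn⁻¹ z) = √3 / 4 * coordP z + 1 / 2 * coordQ z - √3 / 4 * coordR z ∧
    coordR (turn⁻¹ z) = 1 / 4 * coordP z + √3 / 2 * coordQ z + 3 / 4 * coordR z := by
  have h3 : √3 * √3 = 3 := Real.mul_self_sqrt (by norm_num)
  obtain ⟨h1, h2, h4⟩ := turn_coord (turn⁻¹ z)
  rw [show turn (turn⁻¹ z) = z from turn.apply_symm_apply z] at h1 h2 h4
  rw [h1, h2, h4]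
  clear * - h3
  generalize √3 = b at *
  refine ⟨?_, ?_, ?_⟩ <;> grind

theorem quarterTurn_coord (z : ℍ) :
    coordP (quarterTurn z) = 1 / 2 * coordP z + (√3 + √2) * coordQ z
      + (5 / 2 + √2 * √3) * coordR z ∧
    coordQ (quarterTurn z) = (√2 - √3) / 2 * coordP z + (√2 + √3) / 2 * coordR z ∧
    coordR (quarterTurn z) = (5 / 2 - √2 * √3) * coordP z + (√2 - √3) * coordQ z
      + 1 / 2 * coordR z := by
  have h3 : √3 * √3 = 3 := Real.mul_self_sqrt (by norm_num)
  have h2 : √2 * √2 = 2 := Real.mul_self_sqrt (by norm_num)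
  obtain ⟨a1, a2, a3⟩ := halfTurn_coord z
  obtain ⟨b1, b2, b3⟩ := inv_turn_coord (halfTurn z)
  rw [quarterTurn, mul_apply, b1, b2, b3, a1, a2, a3]
  clear * - h2 h3
  generalize √3 = b at *
  generalize √2 = a at *
  refine ⟨?_, ?_, ?_⟩ <;> grind

theorem quarterTurn_sq_coord (z : ℍ) :
    coordP ((quarterTurn ^ 2) z) = (5 + 2 * (√2 * √3)) * coordR z ∧
    coordQ ((quarterTurn ^ 2) z) = -coordQ z ∧
    coordR ((quarterTurn ^ 2) z) = (5 - 2 * (√2 * √3)) * coordP z := by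
  have h3 : √3 * √3 = 3 := Real.mul_self_sqrt (by norm_num)
  have h2 : √2 * √2 = 2 := Real.mul_self_sqrt (by norm_num)
  obtain ⟨a1, a2, a3⟩ := quarterTurn_coord z
  obtain ⟨b1, b2, b3⟩ := quarterTurn_coord (quarterTurn z)
  rw [pow_two, mul_apply, b1, b2, b3, a1, a2, a3]
  clear * - h2 h3
  generalize √3 = b at *
  generalize √2 = a at *
  refine ⟨?_, ?_, ?_⟩ <;> grind

/-- This is where the right angles of the hexagon enter: four placed tiles close up around a vertex.
-/
theorem quarterTurn_pow_four : quarterTurn ^ 4 = 1 := by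
  have h3 : √3 * √3 = 3 := Real.mul_self_sqrt (by norm_num)
  have h2 : √2 * √2 = 2 := Real.mul_self_sqrt (by norm_num)
  refine isometryEquiv_eq_of_coord fun z => ?_
  have e : (quarterTurn ^ 4) z = (quarterTurn ^ 2) ((quarterTurn ^ 2) z) := by
    rw [← mul_apply, ← pow_add]
  obtain ⟨a1, a2, a3⟩ := quarterTurn_sq_coord z
  obtain ⟨b1, b2, b3⟩ := quarterTurn_sq_coord ((quarterTurn ^ 2) z)
  rw [e, one_apply, b1, b2, b3, a1, a2, a3]
  clear * - h2 h3
  generalize √3 = b at *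
  generalize √2 = a at *
  refine ⟨?_, ?_, ?_⟩ <;> grind

theorem vertex_eq (j : ZMod 6) : vertex j = (turn ^ j.val) topVertex := by
  rw [turn_pow_apply]
  rfl

/-- The rotation of the hexagon that carries the side with number `0` to the side `j`. -/
noncomputable def rot (j : ZMod 6) : ℍ ≃ᵢ ℍ := turn ^ j.val

theorem rot_add (i j : ZMod 6) : rot (i + j) = rot i * rot j := by
  rw [rot, rot, rot, ZMod.val_add, ← pow_add]
  exact (pow_eq_pow_mod _ turn_pow_six).symm

theorem rot_zero : rot 0 = 1 := by simp [rot]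

theorem rot_one : rot 1 = turn := by
  rw [rot, show (1 : ZMod 6).val = 1 from rfl, pow_one]

theorem rot_neg (i : ZMod 6) : rot (-i) = (rot i)⁻¹ := by
  rw [eq_inv_iff_mul_eq_one, ← rot_add, neg_add_cancel, rot_zero]

theorem rot_vertex (i j : ZMod 6) : rot i (vertex j) = vertex (i + j) := by
  rw [vertex_eq, vertex_eq, ← mul_apply]
  exact congrArg (fun g : ℍ ≃ᵢ ℍ => g topVertex) (rot_add i j).symm

theorem vertex_zero : vertex 0 = topVertex := by
  simp [vertex_eq, one_apply]

theorem rot_vertex_zero (i : ZMod 6) : rot i (vertex 0) = vertex i := by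
  rw [rot_vertex, add_zero]

theorem rot_I (i : ZMod 6) : rot i UpperHalfPlane.I = UpperHalfPlane.I := by
  have : ∀ n : ℕ, (turn ^ n) UpperHalfPlane.I = UpperHalfPlane.I := by
    intro n
    induction n with
    | zero => rfl
    | succ n ih => rw [pow_succ', mul_apply, ih, turn_I]
  exact this _

theorem coord_vertex_one : coordP (vertex 1) = √3 + √2 / 2 ∧ coordQ (vertex 1) = -(√2 * √3) / 2 ∧
    coordR (vertex 1) = √3 - √2 / 2 := by
  obtain ⟨a1, a2, a3⟩ := coord_topVertex
  obtain ⟨b1, b2, b3⟩ := turn_coord topVertex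
  rw [← rot_vertex_zero, rot_one, vertex_zero, b1, b2, b3, a1, a2, a3]
  refine ⟨?_, ?_, ?_⟩ <;> ring

theorem coord_vertex_two : coordP (vertex 2) = √3 - √2 / 2 ∧ coordQ (vertex 2) = -(√2 * √3) / 2 ∧
    coordR (vertex 2) = √3 + √2 / 2 := by
  have h3 : √3 * √3 = 3 := Real.mul_self_sqrt (by norm_num)
  obtain ⟨a1, a2, a3⟩ := coord_vertex_one
  obtain ⟨b1, b2, b3⟩ := turn_coord (vertex 1)
  rw [show (2 : ZMod 6) = 1 + 1 from rfl, ← rot_vertex, rot_one, b1, b2, b3, a1, a2, a3]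
  clear * - h3
  generalize √3 = b at *
  refine ⟨?_, ?_, ?_⟩ <;> grind

theorem coord_vertex_three : coordP (vertex 3) = √3 - √2 ∧ coordQ (vertex 3) = 0 ∧
    coordR (vertex 3) = √3 + √2 := by
  obtain ⟨a1, a2, a3⟩ := coord_topVertex
  obtain ⟨b1, b2, b3⟩ := turn_pow_three_coord topVertex
  rw [vertex_eq, show (3 : ZMod 6).val = 3 from rfl, b1, b2, b3, a1, a2, a3]
  simp

theorem halfTurn_vertex_zero : halfTurn (vertex 0) = vertex 1 := by
  have h3 : √3 * √3 = 3 := Real.mul_self_sqrt (by norm_num)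
  have h2 : √2 * √2 = 2 := Real.mul_self_sqrt (by norm_num)
  obtain ⟨a1, a2, a3⟩ := coord_topVertex
  obtain ⟨b1, b2, b3⟩ := halfTurn_coord topVertex
  obtain ⟨c1, c2, c3⟩ := coord_vertex_one
  rw [vertex_zero]
  rw [a1, a2, a3] at b1 b2 b3
  apply eq_of_coord_eq
  · rw [b1, c1]
    clear * - h2 h3
    generalize √3 = b at *
    generalize √2 = a at *
    grind
  · rw [b2, c2]
    clear * - h2 h3
    generalize √3 = b at *
    generalize √2 = a at *
    grind
  · rw [b3, c3]
    clear * - h2 h3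
    generalize √3 = b at *
    generalize √2 = a at *
    grind

theorem halfTurn_halfTurn (z : ℍ) : halfTurn (halfTurn z) = z := by
  rw [← mul_apply, halfTurn_mul_self, one_apply]

theorem halfTurn_vertex_one : halfTurn (vertex 1) = vertex 0 := by
  rw [← halfTurn_vertex_zero, halfTurn_halfTurn]

theorem quarterTurn_vertex_zero : quarterTurn (vertex 0) = vertex 0 := by
  rw [quarterTurn, mul_apply, halfTurn_vertex_zero, ← rot_one, ← rot_neg, rot_vertex]
  rfl

theorem quarterTurn_pow_vertex_zero (n : ℕ) : (quarterTurn ^ n) (vertex 0) = vertex 0 := by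
  induction n with
  | zero => rfl
  | succ n ih => rw [pow_succ, mul_apply, quarterTurn_vertex_zero, ih]

/-! ### Distances in the hexagon -/

/-- The side length of the hexagon. -/
noncomputable def sideLength : ℝ := dist (vertex 0) (vertex 1)

theorem dist_vertex_add (i j n : ZMod 6) :
    dist (vertex (n + i)) (vertex (n + j)) = dist (vertex i) (vertex j) := by
  rw [← rot_vertex, ← rot_vertex, (rot n).dist_eq]

theorem dist_vertex_add_one (i : ZMod 6) : dist (vertex i) (vertex (i + 1)) = sideLength := by
  have := dist_vertex_add 0 1 i
  rwa [add_zero] at this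

/-- Every later distance estimate in the hexagon reduces to this table. -/
theorem cosh_dist_vertex_zero (j : ZMod 6) : Real.cosh (dist (vertex 0) (vertex j)) =
    ![1, 2, 4, 5, 4, 2] j := by
  have h3 : √3 * √3 = 3 := Real.mul_self_sqrt (by norm_num)
  have h2 : √2 * √2 = 2 := Real.mul_self_sqrt (by norm_num)
  obtain ⟨a1, a2, a3⟩ := coord_topVertex
  obtain ⟨b1, b2, b3⟩ := coord_vertex_one
  obtain ⟨c1, c2, c3⟩ := coord_vertex_two
  obtain ⟨d1, d2, d3⟩ := coord_vertex_three
  have e1 : Real.cosh (dist (vertex 0) (vertex 1)) = 2 := by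
    rw [vertex_zero, cosh_dist_eq_coord, a1, a2, a3, b1, b2, b3]
    linear_combination h3 - h2 / 2
  have e2 : Real.cosh (dist (vertex 0) (vertex 2)) = 4 := by
    rw [vertex_zero, cosh_dist_eq_coord, a1, a2, a3, c1, c2, c3]
    linear_combination h3 + h2 / 2
  have e3 : Real.cosh (dist (vertex 0) (vertex 3)) = 5 := by
    rw [vertex_zero, cosh_dist_eq_coord, a1, a2, a3, d1, d2, d3]
    linear_combination h3 + h2
  fin_cases j
  · change Real.cosh (dist (vertex 0) (vertex 0)) = 1
    rw [dist_self, Real.cosh_zero]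
  · exact e1
  · exact e2
  · exact e3
  · have := dist_vertex_add 0 4 2
    rw [show (2 : ZMod 6) + 4 = 0 from rfl, add_zero] at this
    change Real.cosh (dist (vertex 0) (vertex 4)) = 4
    rw [← this, dist_comm, e2]
  · have := dist_vertex_add 0 5 1
    rw [show (1 : ZMod 6) + 5 = 0 from rfl, add_zero] at this
    change Real.cosh (dist (vertex 0) (vertex 5)) = 2
    rw [← this, dist_comm, e1]

theorem cosh_dist_vertex (i j : ZMod 6) : Real.cosh (dist (vertex i) (vertex j)) =
    ![1, 2, 4, 5, 4, 2] (j - i) := by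
  rw [← cosh_dist_vertex_zero, ← dist_vertex_add 0 (j - i) i, add_zero, add_sub_cancel]

theorem cosh_sideLength : Real.cosh sideLength = 2 := cosh_dist_vertex_zero 1

theorem sideLength_pos : 0 < sideLength := by
  refine dist_nonneg.lt_of_ne fun h => ?_
  have := cosh_sideLength
  rw [sideLength, ← h] at this
  norm_num at this

theorem vertex_injective : Function.Injective vertex := by
  intro i j h
  have h1 := cosh_dist_vertex i j
  rw [h, dist_self, Real.cosh_zero] at h1
  have : ∀ n : ZMod 6, (1 : ℝ) = ![1, 2, 4, 5, 4, 2] n → n = 0 := by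
    intro n hn
    fin_cases n <;> first | rfl | (exfalso; revert hn; simp)
  exact (sub_eq_zero.1 (this _ h1)).symm

theorem cosh_dist_I_vertex (j : ZMod 6) : Real.cosh (dist UpperHalfPlane.I (vertex j)) = √3 := by
  obtain ⟨a1, a2, a3⟩ := coord_topVertex
  obtain ⟨b1, b2, b3⟩ := coord_I
  rw [← rot_vertex_zero, ← rot_I j, (rot j).dist_eq, vertex_zero, cosh_dist_eq_coord, a1, a2, a3,
    b1, b2, b3]
  ring

theorem dist_I_vertex_lt (j : ZMod 6) : dist UpperHalfPlane.I (vertex j) < sideLength := by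
  have h : Real.cosh (dist UpperHalfPlane.I (vertex j)) < Real.cosh sideLength := by
    rw [cosh_dist_I_vertex, cosh_sideLength]
    nlinarith [Real.sq_sqrt (show (0 : ℝ) ≤ 3 by norm_num), Real.sqrt_nonneg 3]
  rwa [Real.cosh_lt_cosh, abs_of_nonneg dist_nonneg, abs_of_pos sideLength_pos] at h

end Hexagon

/-! ### Distances between points of the sides -/

namespace Hexagon

theorem vertex_mem_side (i : ZMod 6) : vertex i ∈ side i := left_mem_seg _ _

theorem vertex_add_one_mem_side (i : ZMod 6) : vertex (i + 1) ∈ side i := right_mem_seg _ _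

theorem side_subset_region (i : ZMod 6) : side i ⊆ region :=
  fun p hp => ⟨i, p, hp, right_mem_seg _ _⟩

theorem vertex_mem_region (i : ZMod 6) : vertex i ∈ region :=
  side_subset_region i (vertex_mem_side i)

theorem seg_I_vertex_subset_region (i : ZMod 6) : seg UpperHalfPlane.I (vertex i) ⊆ region :=
  fun _ hz => ⟨i, vertex i, vertex_mem_side i, hz⟩

theorem I_mem_region : UpperHalfPlane.I ∈ region :=
  seg_I_vertex_subset_region 0 (left_mem_seg _ _)

theorem dist_add_dist_of_mem_side {i : ZMod 6} {p : ℍ} (hp : p ∈ side i) :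
    dist (vertex i) p + dist p (vertex (i + 1)) = sideLength := by
  rw [← dist_vertex_add_one i]
  exact hp

/-- The coordinates of a point of a side are positive combinations of those of the ends. -/
theorem exists_side_coeff {i : ZMod 6} {p : ℍ} (hp : p ∈ side i) :
    ∃ x y : ℝ, 0 ≤ x ∧ 0 ≤ y ∧ x ^ 2 + y ^ 2 + 4 * (x * y) = 1 ∧ ∀ w, Real.cosh (dist w p) =
      x * Real.cosh (dist w (vertex i)) + y * Real.cosh (dist w (vertex (i + 1))) := by
  have hS : 0 < Real.sinh sideLength := Real.sinh_pos_iff.2 sideLength_pos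
  have h := stewart hp
  rw [dist_vertex_add_one] at h
  have hw : ∀ w, Real.cosh (dist w p) = Real.sinh (dist p (vertex (i + 1))) / Real.sinh sideLength
      * Real.cosh (dist w (vertex i)) + Real.sinh (dist (vertex i) p) / Real.sinh sideLength
      * Real.cosh (dist w (vertex (i + 1))) := by
    intro w
    have := h w
    field_simp
    linarith
  refine ⟨_, _, div_nonneg (Real.sinh_nonneg_iff.2 dist_nonneg) hS.le,
    div_nonneg (Real.sinh_nonneg_iff.2 dist_nonneg) hS.le, ?_, hw⟩
  -- The relation between x and y says that the combination has norm 1; the mixed term is 2 cosh ℓ =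
  -- 4.
  have h1 := hw p
  have h2 := hw (vertex i)
  have h3 := hw (vertex (i + 1))
  have hc := cosh_sideLength
  generalize Real.sinh (dist p (vertex (i + 1))) / Real.sinh sideLength = x at *
  generalize Real.sinh (dist (vertex i) p) / Real.sinh sideLength = y at *
  rw [dist_self, Real.cosh_zero, dist_comm p, h2, dist_comm p, h3, dist_self, dist_self,
    dist_comm (vertex (i + 1)) (vertex i), dist_vertex_add_one, Real.cosh_zero, hc] at h1
  linarith

theorem le_dist_of_cosh_le {s : ℝ} {z w : ℍ} (h : Real.cosh s ≤ Real.cosh (dist z w)) :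
    s ≤ dist z w := by
  rw [Real.cosh_le_cosh, abs_of_nonneg (dist_nonneg (x := z))] at h
  exact (le_abs_self s).trans h

/-- The cosh of the distance is x times one entry of the table plus y times the next, and the norm
relation forces x + 2y ≥ 1 and 2x + y ≥ 1. -/
theorem sideLength_le_dist {i j : ZMod 6} {p : ℍ} (hp : p ∈ side j) (h1 : i ≠ j)
    (h2 : i ≠ j + 1) : sideLength ≤ dist (vertex i) p := by
  obtain ⟨x, y, hx, hy, hxy, hw⟩ := exists_side_coeff hp
  apply le_dist_of_cosh_le
  rw [cosh_sideLength, hw, cosh_dist_vertex, cosh_dist_vertex]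
  have e : j + 1 - i = (j - i) + 1 := by ring
  rw [e]
  have h1' : j - i ≠ 0 := fun h => h1 (sub_eq_zero.1 h).symm
  have h2' : j - i + 1 ≠ 0 := fun h => h2 (sub_eq_zero.1 (e.trans h)).symm
  have hs : 1 ≤ 2 * (x + y) := by nlinarith [mul_nonneg hx hy]
  have hs1 : 1 ≤ x + 2 * y := by nlinarith [mul_nonneg hx hy]
  have hs2 : 1 ≤ 2 * x + y := by nlinarith [mul_nonneg hx hy]
  generalize j - i = n at *
  fin_cases n
  · exact absurd rfl h1'
  · change 2 ≤ x * 2 + y * 4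
    linarith
  · change 2 ≤ x * 4 + y * 5
    linarith
  · change 2 ≤ x * 5 + y * 4
    linarith
  · change 2 ≤ x * 4 + y * 2
    linarith
  · exact absurd rfl h2'

/-- Two different sides meet in vertices only. -/
theorem eq_vertex_of_mem_side {i j : ZMod 6} (hij : i ≠ j) {p : ℍ} (hi : p ∈ side i)
    (hj : p ∈ side j) : p = vertex i ∨ p = vertex (i + 1) := by
  by_contra! h
  have h0 := dist_add_dist_of_mem_side hi
  have h1 : 0 < dist (vertex i) p := dist_pos.2 h.1.symm
  have h2 : 0 < dist p (vertex (i + 1)) := dist_pos.2 h.2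
  have a1 : i = j + 1 := by
    by_contra hne
    have := sideLength_le_dist hj hij hne
    linarith
  have a2 : i + 1 = j := by
    by_contra hne
    have := sideLength_le_dist hj hne (by simpa using hij)
    rw [dist_comm] at this
    linarith
  rw [← a2, add_assoc] at a1
  exact absurd (left_eq_add.1 a1) (by decide)

/-- Near an interior point of a side there are no points of other sides, with the distance to the
ends as admissible radius. After expanding both points in vertices, only the table and the norm
relations are needed. -/
theorem le_dist_of_mem_side {i j : ZMod 6} (hij : j ≠ i) {p q : ℍ} (hp : p ∈ side i)
    (hq : q ∈ side j) {s : ℝ} (hs0 : 0 ≤ s) (h1 : s ≤ dist (vertex i) p)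
    (h2 : s ≤ dist p (vertex (i + 1))) : s ≤ dist p q := by
  obtain ⟨x, y, hx, hy, hxy, hw⟩ := exists_side_coeff hp
  obtain ⟨x', y', hx', hy', hxy', hw'⟩ := exists_side_coeff hq
  have c1 : Real.cosh s ≤ x + 2 * y := by
    have : Real.cosh s ≤ Real.cosh (dist (vertex i) p) := by
      rwa [Real.cosh_le_cosh, abs_of_nonneg hs0, abs_of_nonneg dist_nonneg]
    rw [hw, dist_self, Real.cosh_zero, dist_vertex_add_one, cosh_sideLength] at this
    linarith
  have c2 : Real.cosh s ≤ 2 * x + y := by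
    have : Real.cosh s ≤ Real.cosh (dist (vertex (i + 1)) p) := by
      rwa [Real.cosh_le_cosh, abs_of_nonneg hs0, abs_of_nonneg dist_nonneg, dist_comm]
    rw [hw, dist_self, Real.cosh_zero, dist_comm, dist_vertex_add_one, cosh_sideLength] at this
    linarith
  apply le_dist_of_cosh_le
  rw [hw', dist_comm p, dist_comm p, hw, hw, cosh_dist_vertex, cosh_dist_vertex, cosh_dist_vertex,
    cosh_dist_vertex]
  have hs : 4 ≤ 5 * (x' + y') := by nlinarith [mul_nonneg hx' hy', sq_nonneg (x' - y')]
  have hs1 : 1 ≤ x' + 2 * y' := by nlinarith [mul_nonneg hx' hy']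
  have hs2 : 1 ≤ 2 * x' + y' := by nlinarith [mul_nonneg hx' hy']
  have hne : j - i ≠ 0 := sub_ne_zero.2 hij
  rw [show i - j = -(j - i) by ring, show i + 1 - j = -(j - i) + 1 by ring,
    show i - (j + 1) = -(j - i) - 1 by ring, show i + 1 - (j + 1) = -(j - i) by ring]
  generalize j - i = n at *
  have hc : 0 < Real.cosh s := Real.cosh_pos s
  fin_cases n
  · exact absurd rfl hne
  · change Real.cosh s ≤ x' * (x * 2 + y * 1) + y' * (x * 4 + y * 2)
    nlinarith
  · change Real.cosh s ≤ x' * (x * 4 + y * 2) + y' * (x * 5 + y * 4)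
    nlinarith [mul_nonneg hx' hx, mul_nonneg hx' hy, mul_nonneg hy' hx, mul_nonneg hy' hy]
  · change Real.cosh s ≤ x' * (x * 5 + y * 4) + y' * (x * 4 + y * 5)
    nlinarith [mul_nonneg hx' hx, mul_nonneg hx' hy, mul_nonneg hy' hx, mul_nonneg hy' hy]
  · change Real.cosh s ≤ x' * (x * 4 + y * 5) + y' * (x * 2 + y * 4)
    nlinarith [mul_nonneg hx' hx, mul_nonneg hx' hy, mul_nonneg hy' hx, mul_nonneg hy' hy]
  · change Real.cosh s ≤ x' * (x * 2 + y * 4) + y' * (x * 1 + y * 2)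
    nlinarith

/-- From cosh²(ℓ/2) = 3/2 one gets cosh(3ℓ/2) = 3√(3/2) < 4, whereas non-adjacent distinct vertices
have cosh of the distance at least 4. -/
theorem eq_or_adjacent_of_dist_lt {i j : ZMod 6}
    (h : dist (vertex i) (vertex j) < 3 / 2 * sideLength) : j = i ∨ j = i + 1 ∨ i = j + 1 := by
  have hc : Real.cosh (dist (vertex i) (vertex j)) < 4 := by
    have h1 : Real.cosh (dist (vertex i) (vertex j)) < Real.cosh (3 / 2 * sideLength) := by
      rw [Real.cosh_lt_cosh, abs_of_nonneg dist_nonneg]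
      exact h.trans_le (le_abs_self _)
    have h2 := Real.cosh_three_mul (sideLength / 2)
    have h3 := Real.cosh_two_mul (sideLength / 2)
    have h4 := Real.cosh_sq (sideLength / 2)
    have h5 := Real.cosh_pos (sideLength / 2)
    rw [show 2 * (sideLength / 2) = sideLength by ring, cosh_sideLength] at h3
    rw [show 3 * (sideLength / 2) = 3 / 2 * sideLength by ring] at h2
    have h6 : Real.cosh (sideLength / 2) ^ 2 = 3 / 2 := by linarith
    have h7 : Real.cosh (sideLength / 2) ^ 3 = 3 / 2 * Real.cosh (sideLength / 2) := by
      rw [pow_succ, h6]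
    rw [h7] at h2
    nlinarith
  rw [cosh_dist_vertex] at hc
  have key : ∀ n : ZMod 6, (![1, 2, 4, 5, 4, 2] n : ℝ) < 4 → n = 0 ∨ n = 1 ∨ n = -1 := by
    intro n hn
    fin_cases n
    · exact Or.inl rfl
    · exact Or.inr (Or.inl rfl)
    · exact absurd (show (4 : ℝ) < 4 from hn) (by norm_num)
    · exact absurd (show (5 : ℝ) < 4 from hn) (by norm_num)
    · exact absurd (show (4 : ℝ) < 4 from hn) (by norm_num)
    · exact Or.inr (Or.inr rfl)
  rcases key _ hc with h | h | h
  · exact Or.inl (sub_eq_zero.1 h)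
  · exact Or.inr (Or.inl (by rw [← h]; ring))
  · refine Or.inr (Or.inr ?_)
    have : j = i + -1 := by rw [← h]; ring
    rw [this]; ring

/-- The isometry that places next to the hexagon, along its side `i`, a second one with the side
`j` along that side. -/
noncomputable def glueIso (i j : ZMod 6) : ℍ ≃ᵢ ℍ := rot i * halfTurn * (rot j)⁻¹

theorem glueIso_inv (i j : ZMod 6) : (glueIso i j)⁻¹ = glueIso j i := by
  have h : halfTurn⁻¹ = halfTurn := inv_eq_of_mul_eq_one_left halfTurn_mul_self
  simp [glueIso, mul_assoc, h]

theorem glueIso_vertex (i j : ZMod 6) : glueIso i j (vertex j) = vertex (i + 1) := by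
  rw [glueIso, mul_apply, mul_apply, ← rot_neg, rot_vertex, neg_add_cancel, halfTurn_vertex_zero,
    rot_vertex]

theorem glueIso_vertex_add_one (i j : ZMod 6) : glueIso i j (vertex (j + 1)) = vertex i := by
  rw [glueIso, mul_apply, mul_apply, ← rot_neg, rot_vertex, neg_add_cancel_left,
    halfTurn_vertex_one, rot_vertex, add_zero]

theorem glueIso_mem_side {i j : ZMod 6} {q : ℍ} (hq : q ∈ side j) : glueIso i j q ∈ side i := by
  rw [side, seg_comm, ← glueIso_vertex i j]
  conv => arg 1; rw [← glueIso_vertex_add_one i j]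
  exact (map_mem_seg _).2 hq

theorem eq_glueIso {i j : ZMod 6} {p q : ℍ} (hp : p ∈ side i) (hq : q ∈ side j)
    (h : dist (vertex i) p = dist (vertex (j + 1)) q) : p = glueIso i j q := by
  refine eq_of_mem_seg hp (glueIso_mem_side hq) ?_
  rw [h, ← (glueIso i j).dist_eq, glueIso_vertex_add_one]

/-! ### The translation along a side -/

/-- The translation along the side with number `0`, from its start to its end. -/
noncomputable def translation : ℍ ≃ᵢ ℍ := turn * halfTurn * turn

theorem translation_vertex_zero : translation (vertex 0) = vertex 1 := by
  rw [translation, mul_apply, mul_apply, ← rot_one, rot_vertex, add_zero, halfTurn_vertex_one,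
    rot_vertex, add_zero]

/-- A linear form that vanishes on the axis of the translation; up to a factor it is the
hyperbolic sine of the signed distance to this axis. -/
noncomputable def axisForm (z : ℍ) : ℝ :=
  (√2 - √3) / 2 * coordP z + coordQ z + (√2 + √3) / 2 * coordR z

theorem axisForm_translation (z : ℍ) : axisForm (translation z) = axisForm z := by
  have h3 : √3 * √3 = 3 := Real.mul_self_sqrt (by norm_num)
  have h2 : √2 * √2 = 2 := Real.mul_self_sqrt (by norm_num)
  obtain ⟨a1, a2, a3⟩ := turn_coord z
  obtain ⟨b1, b2, b3⟩ := halfTurn_coord (turn z)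
  obtain ⟨c1, c2, c3⟩ := turn_coord (halfTurn (turn z))
  rw [axisForm, axisForm, translation, mul_apply, mul_apply, c1, c2, c3, b1, b2, b3, a1, a2, a3]
  clear * - h2 h3
  generalize √3 = b at *
  generalize √2 = a at *
  grind

theorem axisForm_translation_pow (n : ℕ) (z : ℍ) :
    axisForm ((translation ^ n) z) = axisForm z := by
  induction n with
  | zero => rfl
  | succ n ih => rw [pow_succ', mul_apply, axisForm_translation, ih]

theorem axisForm_vertex_zero : axisForm (vertex 0) = 0 := by
  obtain ⟨a1, a2, a3⟩ := coord_topVertex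
  rw [axisForm, vertex_zero, a1, a2, a3]
  ring

/-- This and the next value belong to the ends of the two edges perpendicular to the axis at vertex
0, one on either side of it. -/
theorem axisForm_inv_turn_vertex_zero : axisForm (turn⁻¹ (vertex 0)) = √2 * √3 := by
  have h3 : √3 * √3 = 3 := Real.mul_self_sqrt (by norm_num)
  have h2 : √2 * √2 = 2 := Real.mul_self_sqrt (by norm_num)
  obtain ⟨a1, a2, a3⟩ := coord_topVertex
  obtain ⟨b1, b2, b3⟩ := inv_turn_coord topVertex
  rw [axisForm, vertex_zero, b1, b2, b3, a1, a2, a3]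
  clear * - h2 h3
  generalize √3 = b at *
  generalize √2 = a at *
  grind

theorem axisForm_halfTurn_vertex_two : axisForm (halfTurn (vertex 2)) = -(√2 * √3) := by
  have h3 : √3 * √3 = 3 := Real.mul_self_sqrt (by norm_num)
  have h2 : √2 * √2 = 2 := Real.mul_self_sqrt (by norm_num)
  obtain ⟨a1, a2, a3⟩ := coord_vertex_two
  obtain ⟨b1, b2, b3⟩ := halfTurn_coord (vertex 2)
  rw [axisForm, b1, b2, b3, a1, a2, a3]
  clear * - h2 h3
  generalize √3 = b at *
  generalize √2 = a at *
  grind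

/-- A linear form vanishing on the line of the side with number `4`. -/
noncomputable def sideForm (z : ℍ) : ℝ := axisForm (turn (turn z))

theorem sideForm_eq (z : ℍ) :
    sideForm z = √2 / 2 * coordP z - 2 * coordQ z + √2 / 2 * coordR z := by
  have h3 : √3 * √3 = 3 := Real.mul_self_sqrt (by norm_num)
  obtain ⟨a1, a2, a3⟩ := turn_coord z
  obtain ⟨b1, b2, b3⟩ := turn_coord (turn z)
  rw [sideForm, axisForm, b1, b2, b3, a1, a2, a3]
  clear * - h3
  generalize √3 = b at *
  generalize √2 = a at *
  grind

theorem translation_coord (z : ℍ) :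
    coordP (translation z) = (7 - 2 * (√2 * √3)) / 4 * coordP z - (2 * √2 + √3) / 2 * coordQ z
      + (5 + 2 * (√2 * √3)) / 4 * coordR z ∧
    coordQ (translation z) = (3 * √3 - 4 * √2) / 4 * coordP z + 3 / 2 * coordQ z
      - (3 * √3 + 4 * √2) / 4 * coordR z ∧
    coordR (translation z) = (5 - 2 * (√2 * √3)) / 4 * coordP z + (√3 - 2 * √2) / 2 * coordQ z
      + (7 + 2 * (√2 * √3)) / 4 * coordR z := by
  have h3 : √3 * √3 = 3 := Real.mul_self_sqrt (by norm_num)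
  have h2 : √2 * √2 = 2 := Real.mul_self_sqrt (by norm_num)
  obtain ⟨a1, a2, a3⟩ := turn_coord z
  obtain ⟨b1, b2, b3⟩ := halfTurn_coord (turn z)
  obtain ⟨c1, c2, c3⟩ := turn_coord (halfTurn (turn z))
  rw [translation, mul_apply, mul_apply, c1, c2, c3, b1, b2, b3, a1, a2, a3]
  clear * - h2 h3
  generalize √3 = b at *
  generalize √2 = a at *
  refine ⟨?_, ?_, ?_⟩ <;> grind

/-- On the linear coordinates the translation has eigenvalues 1 and e^{±ℓ}, with e^ℓ + e^{-ℓ} = 4.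
Hence T² - 4T + 1 kills all but the invariant component, which `axisForm` measures. -/
theorem sideForm_translation_sq (z : ℍ) : sideForm (translation (translation z)) =
    4 * sideForm (translation z) - sideForm z + 4 * axisForm z := by
  have h3 : √3 * √3 = 3 := Real.mul_self_sqrt (by norm_num)
  have h2 : √2 * √2 = 2 := Real.mul_self_sqrt (by norm_num)
  obtain ⟨a1, a2, a3⟩ := translation_coord z
  obtain ⟨b1, b2, b3⟩ := translation_coord (translation z)
  rw [sideForm_eq, sideForm_eq, sideForm_eq, axisForm, b1, b2, b3, a1, a2, a3]
  clear * - h2 h3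
  generalize √3 = b at *
  generalize √2 = a at *
  grind

theorem axisForm_vertex_three : axisForm (vertex 3) = 2 * (√2 * √3) := by
  obtain ⟨a1, a2, a3⟩ := coord_vertex_three
  rw [axisForm, a1, a2, a3]
  ring

/-- The lines of the sides 0 and 4 have side 5 as a common perpendicular. Translating vertex 3 along
the first line never brings it to the second. By the recursion, whose inhomogeneous term is positive
here, the values increase from √6 and 12√6 on. -/
theorem sideForm_translation_pow_pos (n : ℕ) : 0 < sideForm ((translation ^ n) (vertex 3)) := by
  have h3 : √3 * √3 = 3 := Real.mul_self_sqrt (by norm_num)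
  have h2 : √2 * √2 = 2 := Real.mul_self_sqrt (by norm_num)
  have hpos : 0 < √2 * √3 := by positivity
  obtain ⟨a1, a2, a3⟩ := coord_vertex_three
  have h0 : sideForm (vertex 3) = √2 * √3 := by
    rw [sideForm_eq, a1, a2, a3]
    ring
  have h1 : sideForm (vertex 3) ≤ sideForm (translation (vertex 3)) := by
    obtain ⟨b1, b2, b3⟩ := translation_coord (vertex 3)
    have : sideForm (translation (vertex 3)) = 12 * (√2 * √3) := by
      rw [sideForm_eq, b1, b2, b3, a1, a2, a3]
      clear * - h2 h3
      generalize √3 = b at *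
      generalize √2 = a at *
      grind
    rw [h0, this]
    linarith
  suffices h : 0 < sideForm ((translation ^ n) (vertex 3)) ∧
      sideForm ((translation ^ n) (vertex 3)) ≤ sideForm ((translation ^ (n + 1)) (vertex 3)) from h.1
  induction n with
  | zero => exact ⟨h0 ▸ hpos, h1⟩
  | succ n ih =>
    refine ⟨ih.1.trans_le ih.2, ?_⟩
    have e := sideForm_translation_sq ((translation ^ n) (vertex 3))
    rw [axisForm_translation_pow, axisForm_vertex_three] at e
    have e1 : (translation ^ (n + 1)) (vertex 3) = translation ((translation ^ n) (vertex 3)) := by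
      rw [pow_succ', mul_apply]
    have e2 : (translation ^ (n + 1 + 1)) (vertex 3) =
        translation (translation ((translation ^ n) (vertex 3))) := by
      rw [pow_succ', mul_apply, e1]
    rw [e2, e, ← e1]
    linarith [ih.1, ih.2]

end Hexagon

/-! ### Chain metrics -/

/-- The infimum of the lengths of the chains from `x` to `y`, measured by `d`. -/
noncomputable def chainEDist {X : Type*} (d : X → X → ℝ≥0∞) (x y : X) : ℝ≥0∞ :=
  ⨅ l : List X, (List.zipWith d (x :: l) (l ++ [y])).sum

/-- The universal property of the chain metric: a Lipschitz estimate has to be checked on single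
steps, here inside one tile, only. All lower bounds for distances in the glued spaces come from it.
-/
theorem le_add_chainEDist {X : Type*} {d : X → X → ℝ≥0∞} {u : X → ℝ≥0∞}
    (h : ∀ x y, u y ≤ u x + d x y) (x y : X) : u y ≤ u x + chainEDist d x y := by
  rw [chainEDist, ENNReal.add_iInf]
  refine le_iInf fun l => ?_
  induction l generalizing x with
  | nil => simpa using h x y
  | cons z l ih =>
    rw [List.cons_append, List.zipWith_cons_cons, List.sum_cons, ← add_assoc]
    exact (ih z).trans (add_le_add_left (h x z) _)

theorem edist_le_chainEDist {X Y : Type*} [PseudoEMetricSpace Y] {d : X → X → ℝ≥0∞} {φ : X → Y}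
    (h : ∀ x y, edist (φ x) (φ y) ≤ d x y) (x y : X) :
    edist (φ x) (φ y) ≤ chainEDist d x y := by
  have := le_add_chainEDist (d := d) (u := fun y => edist (φ x) (φ y))
    (fun a b => (edist_triangle _ (φ a) _).trans (add_le_add_right (h a b) _)) x y
  simpa using this

theorem chainEDist_le {X : Type*} (d : X → X → ℝ≥0∞) (x y : X) : chainEDist d x y ≤ d x y :=
  (iInf_le _ []).trans_eq (by simp)

namespace HexTessellation

variable {F : Type*} (T : HexTessellation F)

open Hexagon

theorem edist_point_le (f : F) (p q : region) :
    edist (T.point f p) (T.point f q) ≤ edist (p : ℍ) (q : ℍ) :=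
  (chainEDist_le T.tileDist _ _).trans <| iInf_le_of_le f <| iInf_le_of_le p <|
    iInf_le_of_le q <| iInf_le_of_le rfl <| iInf_le_of_le rfl le_rfl

theorem edist_le_of_tile {Y : Type*} [PseudoEMetricSpace Y] {φ : T.Surface → Y}
    (h : ∀ f p q, edist (φ (T.point f p)) (φ (T.point f q)) ≤ edist (p : ℍ) (q : ℍ))
    (x y : T.Surface) : edist (φ x) (φ y) ≤ edist x y := by
  refine edist_le_chainEDist (d := T.tileDist) (fun x y => ?_) x y
  refine le_iInf fun f => le_iInf fun p => le_iInf fun q => le_iInf fun hp => le_iInf fun hq => ?_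
  rw [← hp, ← hq]
  exact h f p q

variable {T} in
theorem Glued.symm {x y : F × region} (h : T.Glued x y) : T.Glued y x := by
  obtain ⟨i, j, hg, hx, hy, hd⟩ := h
  refine ⟨j, i, by rw [← hg, T.glue_involutive], hy, hx, ?_⟩
  have h1 := dist_add_dist_of_mem_side hx
  have h2 := dist_add_dist_of_mem_side hy
  rw [dist_comm _ (y.2 : ℍ)] at hd
  rw [dist_comm _ (x.2 : ℍ)]
  linarith

/-! ### The space of developments -/

/-- The tiles of the surface are placed in the hyperbolic plane in all possible ways; two placed
tiles are glued along a side if the corresponding tiles of the surface are glued along this side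
and the placed tiles are adjacent there. -/
def DevGlued (x y : (F × (ℍ ≃ᵢ ℍ)) × region) : Prop :=
  ∃ i j : ZMod 6, T.glue (x.1.1, i) = (y.1.1, j) ∧ y.1.2 = x.1.2 * glueIso i j ∧
    (x.2 : ℍ) ∈ side i ∧ (y.2 : ℍ) ∈ side j ∧
    dist (vertex i) (x.2 : ℍ) = dist (vertex (j + 1)) (y.2 : ℍ)

/-- The space of germs of developments of the surface into the hyperbolic plane: a covering space
of the surface. -/
def Dev : Type _ := Quot T.DevGlued

/-- The point `p` of the tile `f`, placed by `g`. -/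
def devPoint (f : F) (g : ℍ ≃ᵢ ℍ) (p : region) : T.Dev := Quot.mk T.DevGlued ((f, g), p)

theorem exists_devPoint (e : T.Dev) : ∃ f g p, T.devPoint f g p = e := by
  obtain ⟨⟨⟨f, g⟩, p⟩, rfl⟩ := Quot.exists_rep e
  exact ⟨f, g, p, rfl⟩

variable {T} in
theorem DevGlued.glued {x y : (F × (ℍ ≃ᵢ ℍ)) × region} (h : T.DevGlued x y) :
    T.Glued (x.1.1, x.2) (y.1.1, y.2) := by
  obtain ⟨i, j, hg, -, hx, hy, hd⟩ := h
  exact ⟨i, j, hg, hx, hy, hd⟩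

variable {T} in
theorem DevGlued.symm {x y : (F × (ℍ ≃ᵢ ℍ)) × region} (h : T.DevGlued x y) : T.DevGlued y x := by
  obtain ⟨i, j, hg, hgg, hx, hy, hd⟩ := h
  refine ⟨j, i, by rw [← hg, T.glue_involutive], ?_, hy, hx, ?_⟩
  · rw [hgg, ← glueIso_inv i j, mul_inv_cancel_right]
  · have h1 := dist_add_dist_of_mem_side hx
    have h2 := dist_add_dist_of_mem_side hy
    rw [dist_comm _ (y.2 : ℍ)] at hd
    rw [dist_comm _ (x.2 : ℍ)]
    linarith

variable {T} in
theorem DevGlued.apply_eq {x y : (F × (ℍ ≃ᵢ ℍ)) × region} (h : T.DevGlued x y) :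
    x.1.2 (x.2 : ℍ) = y.1.2 (y.2 : ℍ) := by
  obtain ⟨i, j, hg, hgg, hx, hy, hd⟩ := h
  rw [hgg, mul_apply, ← eq_glueIso hx hy hd]

/-- The projection to the surface. -/
def proj : T.Dev → T.Surface :=
  Quot.lift (fun x => T.point x.1.1 x.2) fun _ _ h => Quot.sound h.glued

/-- The developing map. -/
noncomputable def develop : T.Dev → ℍ := Quot.lift (fun x => x.1.2 (x.2 : ℍ)) fun _ _ h => h.apply_eq

theorem develop_devPoint (f : F) (g : ℍ ≃ᵢ ℍ) (p : region) :
    T.develop (T.devPoint f g p) = g (p : ℍ) := rfl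

/-- The hyperbolic distance of two points inside a common placed tile (`∞` if there is none). -/
noncomputable def devTileDist (x y : T.Dev) : ℝ≥0∞ :=
  ⨅ (f : F) (g : ℍ ≃ᵢ ℍ) (p : region) (q : region) (_ : T.devPoint f g p = x)
    (_ : T.devPoint f g q = y), edist (p : ℍ) (q : ℍ)

theorem devTileDist_devPoint_le (f : F) (g : ℍ ≃ᵢ ℍ) (p q : region) :
    T.devTileDist (T.devPoint f g p) (T.devPoint f g q) ≤ edist (p : ℍ) (q : ℍ) :=
  iInf_le_of_le f <| iInf_le_of_le g <| iInf_le_of_le p <|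
    iInf_le_of_le q <| iInf_le_of_le rfl <| iInf_le_of_le rfl le_rfl

theorem devTileDist_self (x : T.Dev) : T.devTileDist x x = 0 := by
  obtain ⟨f, g, p, rfl⟩ := T.exists_devPoint x
  exact nonpos_iff_eq_zero.1 ((T.devTileDist_devPoint_le f g p p).trans_eq (edist_self _))

theorem devTileDist_le (x y : T.Dev) : T.devTileDist x y ≤ T.devTileDist y x := by
  refine le_iInf fun f => le_iInf fun g => le_iInf fun p => le_iInf fun q => le_iInf fun hp =>
    le_iInf fun hq => ?_
  rw [← hp, ← hq, edist_comm]
  exact T.devTileDist_devPoint_le f g q p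

theorem devTileDist_comm (x y : T.Dev) : T.devTileDist x y = T.devTileDist y x :=
  le_antisymm (T.devTileDist_le x y) (T.devTileDist_le y x)

noncomputable instance : PseudoEMetricSpace T.Dev where
  edist x y := chainEDist T.devTileDist x y
  edist_self x := nonpos_iff_eq_zero.1 <| (chainEDist_le _ x x).trans_eq (T.devTileDist_self x)
  edist_comm x y := by
    refine List.reverse_surjective.iInf_congr _ fun l => ?_
    rw [← List.sum_reverse, List.reverse_zipWith, List.reverse_append, List.reverse_reverse,
      List.reverse_singleton, List.singleton_append, List.reverse_cons, List.reverse_reverse,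
      List.zipWith_comm_of_comm T.devTileDist_comm]
    simp only [List.length, List.length_append]
  edist_triangle x y z := by
    refine le_add_chainEDist (u := fun z => chainEDist T.devTileDist x z) (fun y z => ?_) y z
    rw [chainEDist, chainEDist, ENNReal.iInf_add]
    refine le_iInf fun l => iInf_le_of_le (l ++ [y]) ?_
    rw [← List.cons_append, List.zipWith_append (by simp)]
    simp

theorem edist_devPoint_le (f : F) (g : ℍ ≃ᵢ ℍ) (p q : region) :
    edist (T.devPoint f g p) (T.devPoint f g q) ≤ edist (p : ℍ) (q : ℍ) :=
  (chainEDist_le T.devTileDist _ _).trans (T.devTileDist_devPoint_le f g p q)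

theorem edist_le_of_devTile {Y : Type*} [PseudoEMetricSpace Y] {φ : T.Dev → Y}
    (h : ∀ f g p q, edist (φ (T.devPoint f g p)) (φ (T.devPoint f g q)) ≤ edist (p : ℍ) (q : ℍ))
    (x y : T.Dev) : edist (φ x) (φ y) ≤ edist x y := by
  refine edist_le_chainEDist (d := T.devTileDist) (fun x y => ?_) x y
  refine le_iInf fun f => le_iInf fun g => le_iInf fun p => le_iInf fun q => le_iInf fun hp =>
    le_iInf fun hq => ?_
  rw [← hp, ← hq]
  exact h f g p q

theorem edist_proj_le (x y : T.Dev) : edist (T.proj x) (T.proj y) ≤ edist x y :=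
  T.edist_le_of_devTile (fun f _ p q => T.edist_point_le f p q) x y

/-- A point of the development space has a representative in each tile that contains its
projection. -/
theorem exists_devPoint_eq {e : T.Dev} {f : F} {p : region} (h : T.proj e = T.point f p) :
    ∃ g, e = T.devPoint f g p := by
  have key : ∀ x y : F × region, Relation.EqvGen T.Glued x y →
      (∀ g, ∃ g', T.devPoint x.1 g x.2 = T.devPoint y.1 g' y.2) ∧
      (∀ g, ∃ g', T.devPoint y.1 g y.2 = T.devPoint x.1 g' x.2) := by
    have base : ∀ x y : F × region, T.Glued x y →
        ∀ g, ∃ g', T.devPoint x.1 g x.2 = T.devPoint y.1 g' y.2 := by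
      rintro x y ⟨i, j, hg, hx, hy, hd⟩ g
      exact ⟨g * glueIso i j, Quot.sound ⟨i, j, hg, rfl, hx, hy, hd⟩⟩
    intro x y h
    induction h with
    | rel x y h => exact ⟨base x y h, base y x h.symm⟩
    | refl x => exact ⟨fun g => ⟨g, rfl⟩, fun g => ⟨g, rfl⟩⟩
    | symm x y _ ih => exact ⟨ih.2, ih.1⟩
    | trans x y z _ _ ih1 ih2 =>
      refine ⟨fun g => ?_, fun g => ?_⟩
      · obtain ⟨g', h1⟩ := ih1.1 g
        obtain ⟨g'', h2⟩ := ih2.1 g'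
        exact ⟨g'', h1.trans h2⟩
      · obtain ⟨g', h1⟩ := ih2.2 g
        obtain ⟨g'', h2⟩ := ih1.2 g'
        exact ⟨g'', h1.trans h2⟩
  obtain ⟨f', g', p', rfl⟩ := T.exists_devPoint e
  exact (key (f', p') (f, p) (Quot.eqvGen_exact h)).1 g'

/-- The projection maps balls onto balls. -/
theorem exists_lift {e : T.Dev} {y : T.Surface} {ε : ℝ≥0∞} (h : edist (T.proj e) y < ε) :
    ∃ e', T.proj e' = y ∧ edist e e' < ε := by
  -- The distance from e to the fibre is Lipschitz on the surface, because a step inside a tile can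
  -- be lifted from any point over its start.
  set u : T.Surface → ℝ≥0∞ := fun y => ⨅ (e' : T.Dev) (_ : T.proj e' = y), edist e e' with hu
  have h0 : u (T.proj e) = 0 :=
    nonpos_iff_eq_zero.1 ((iInf₂_le (f := fun e' (_ : T.proj e' = T.proj e) => edist e e')
      e rfl).trans_eq (edist_self e))
  have h1 : u y ≤ u (T.proj e) + edist (T.proj e) y := by
    refine le_add_chainEDist (d := T.tileDist) (fun x y => ?_) _ _
    rw [hu, ENNReal.iInf_add]
    refine le_iInf fun e' => ?_
    rw [ENNReal.iInf_add]
    refine le_iInf fun he' => ?_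
    simp only [tileDist, ENNReal.add_iInf]
    refine le_iInf fun f => le_iInf fun p => le_iInf fun q => le_iInf fun hp => le_iInf fun hq => ?_
    obtain ⟨g, rfl⟩ := T.exists_devPoint_eq (he'.trans hp.symm)
    refine (iInf₂_le (T.devPoint f g q) hq).trans ((edist_triangle _ (T.devPoint f g p) _).trans ?_)
    exact add_le_add_right (T.edist_devPoint_le f g p q) _
  rw [h0, zero_add] at h1
  obtain ⟨e', he'⟩ := iInf_lt_iff.1 (h1.trans_lt h)
  obtain ⟨he, hlt⟩ := iInf_lt_iff.1 he'
  exact ⟨e', he, hlt⟩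

end HexTessellation

namespace HexTessellation

variable {F : Type*} (T : HexTessellation F)

open Hexagon

/-! ### Rotation about a vertex -/

/-- The rotation about the starting vertex of a side. -/
def spin (d : F × ZMod 6) : F × ZMod 6 := T.glue (d.1, d.2 - 1)

theorem minimalPeriod_spin (d : F × ZMod 6) : Function.minimalPeriod T.spin d = 4 :=
  T.valence_four d

theorem spin_iterate_four (d : F × ZMod 6) : T.spin^[4] d = d := by
  have := Function.iterate_minimalPeriod (f := T.spin) (x := d)
  rwa [minimalPeriod_spin] at this

theorem four_dvd_of_spin_iterate {d : F × ZMod 6} {m : ℕ} (h : T.spin^[m] d = d) : 4 ∣ m := by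
  rw [← T.minimalPeriod_spin d]
  exact Function.IsPeriodicPt.minimalPeriod_dvd h

theorem glue_glue (d : F × ZMod 6) : T.glue (T.glue d) = d := T.glue_involutive d

theorem glue_injective : Function.Injective T.glue := T.glue_involutive.injective

theorem next_injective : Function.Injective (next : F × ZMod 6 → F × ZMod 6) := by
  rintro ⟨f, i⟩ ⟨f', i'⟩ h
  simpa [next] using h

theorem spin_next (d : F × ZMod 6) : T.spin (next d) = T.glue d := by
  simp [spin, next]

theorem spin_next_glue (d : F × ZMod 6) : T.spin (next (T.glue d)) = d := by
  rw [spin_next, glue_glue]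

theorem next_glue_spin (d : F × ZMod 6) : next (T.glue (T.spin d)) = d := by
  rw [spin, glue_glue]
  simp [next]

theorem spin_iterate_three (d : F × ZMod 6) : T.spin^[3] d = next (T.glue d) := by
  rw [← T.spin_iterate_four (next (T.glue d)), Function.iterate_succ_apply T.spin 3,
    spin_next_glue]

theorem even_spin (d : F × ZMod 6) : Even (T.spin d).2 ↔ ¬ Even d.2 := by
  rw [spin, T.glue_colour]
  have : ∀ i : ZMod 6, Even (i - 1) ↔ ¬ Even i := by
    unfold Even
    decide
  exact this d.2

theorem even_next (d : F × ZMod 6) : Even (next d).2 ↔ ¬ Even d.2 := by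
  have : ∀ i : ZMod 6, Even (i + 1) ↔ ¬ Even i := by
    unfold Even
    decide
  exact this d.2

theorem even_spin_iterate (d : F × ZMod 6) (m : ℕ) :
    Even (T.spin^[m] d).2 ↔ (Even d.2 ↔ Even m) := by
  induction m with
  | zero => simp
  | succ m ih =>
    rw [Function.iterate_succ_apply', even_spin, ih, Nat.even_add_one]
    tauto

/-- No edge is a loop. -/
theorem spin_iterate_ne_next {k : ℕ} (hk : 3 ≤ k) (hreg : T.IsRegular k) (d : F × ZMod 6) (m : ℕ) :
    T.spin^[m] d ≠ next d := by
  intro h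
  have h1 := T.even_spin_iterate d m
  rw [h, even_next] at h1
  have h4 : T.spin^[m % 4] d = next d := by
    rw [← h, ← T.minimalPeriod_spin d, Function.iterate_mod_minimalPeriod_eq]
  have hodd : ¬ Even m := by tauto
  have hm : m % 4 = 1 ∨ m % 4 = 3 := by
    rw [Nat.even_iff] at hodd
    omega
  -- The colours make m odd. If m ≡ 1 mod 4, the edge continues into itself and its curve has a
  -- single edge; if m ≡ 3, the side is glued to itself.
  rcases hm with hm | hm
  · rw [hm, Function.iterate_one] at h4
    have hs : T.straight d = d := by rw [straight, ← h4, next_glue_spin]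
    have hc : T.curveEdges d = {T.edge d} := by
      ext x
      simp only [curveEdges, Set.mem_range, Set.mem_singleton_iff]
      constructor
      · rintro ⟨n, rfl⟩
        rw [Function.iterate_fixed hs]
      · rintro rfl
        exact ⟨0, rfl⟩
    have := hreg d
    rw [hc, Set.ncard_singleton] at this
    omega
  · rw [hm, spin_iterate_three] at h4
    exact T.glue_ne d (next_injective h4)

/-! ### The development space covers the surface -/

theorem edist_truncated_dist_le {c : ℝ} {P : Prop} [Decidable P] (a : ℍ) (g : ℍ ≃ᵢ ℍ) (p q : ℍ) :
    edist (if P then min c (dist (g p) a) else c) (if P then min c (dist (g q) a) else c)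
      ≤ edist p q := by
  split_ifs
  · rw [edist_dist, edist_dist]
    refine ENNReal.ofReal_le_ofReal ?_
    rw [Real.dist_eq]
    refine (abs_min_sub_min_le_max _ _ _ _).trans ?_
    rw [sub_self, abs_zero, max_eq_right (abs_nonneg _), ← g.dist_eq p q]
    exact abs_dist_sub_le _ _ _
  · simp

/-- The placed tile `(f, g)` is one of the four placed tiles around the starting vertex of the
side `d₀`, the first of which is placed such that `d₀` is the image under `φ` of the side with
number `0`. -/
def AroundVertex (d₀ : F × ZMod 6) (φ : ℍ ≃ᵢ ℍ) (f : F) (g : ℍ ≃ᵢ ℍ) : Prop :=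
  ∃ (m : ℕ) (i : ZMod 6), T.spin^[m] d₀ = (f, i) ∧ g * rot i = φ * quarterTurn ^ m

variable {T} in
theorem AroundVertex.exists_vertex {d₀ : F × ZMod 6} {φ : ℍ ≃ᵢ ℍ} {f : F} {g : ℍ ≃ᵢ ℍ}
    (h : T.AroundVertex d₀ φ f g) : ∃ (m : ℕ) (i : ZMod 6), T.spin^[m] d₀ = (f, i) ∧
      g * rot i = φ * quarterTurn ^ m ∧ g (vertex i) = φ (vertex 0) := by
  obtain ⟨m, i, h1, h2⟩ := h
  refine ⟨m, i, h1, h2, ?_⟩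
  rw [← rot_vertex_zero, ← mul_apply, h2, mul_apply, quarterTurn_pow_vertex_zero]

-- Within ℓ of the vertex, only the two sides that end there can be crossed, and crossing one of
-- them leads to a neighbouring placed tile around the vertex. This makes the truncated distance
-- well defined.
variable {T} in
theorem AroundVertex.of_devGlued {d₀ : F × ZMod 6} {φ : ℍ ≃ᵢ ℍ} {x y : (F × (ℍ ≃ᵢ ℍ)) × region}
    (hxy : T.DevGlued x y) (h : T.AroundVertex d₀ φ x.1.1 x.1.2)
    (hd : dist (x.1.2 (x.2 : ℍ)) (φ (vertex 0)) < sideLength) :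
    T.AroundVertex d₀ φ y.1.1 y.1.2 := by
  obtain ⟨m, i, h1, h2, h3⟩ := h.exists_vertex
  obtain ⟨i', j, hg, hgg, hx, hy, -⟩ := hxy
  rw [← h3, x.1.2.dist_eq, dist_comm] at hd
  have hi : i = i' ∨ i = i' + 1 := by
    by_contra! hne
    exact absurd (sideLength_le_dist hx hne.1 hne.2) (not_le.2 hd)
  -- Crossing the side that starts at the vertex undoes a rotation, and three further rotations
  -- amount to the inverse of one.
  rcases hi with rfl | rfl
  · refine ⟨m + 3, j + 1, ?_, ?_⟩
    · rw [add_comm, Function.iterate_add_apply, h1, spin_iterate_three, hg]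
      rfl
    · rw [hgg, glueIso, rot_add, rot_one, pow_add, ← mul_assoc φ, ← h2]
      have : quarterTurn ^ 3 = halfTurn * turn := by
        rw [eq_comm, ← mul_right_inj quarterTurn, ← pow_succ', quarterTurn_pow_four, quarterTurn]
        rw [mul_assoc, ← mul_assoc halfTurn, halfTurn_mul_self, one_mul, inv_mul_cancel]
      rw [this]
      simp [mul_assoc]
  · refine ⟨m + 1, j, ?_, ?_⟩
    · rw [Function.iterate_succ_apply', h1, spin, ← hg]
      simp
    · rw [hgg, glueIso, pow_succ, ← mul_assoc φ, ← h2, quarterTurn, rot_add, rot_one]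
      simp [mul_assoc]

open Classical in
/-- The distance to a vertex, truncated at `c`. -/
noncomputable def vertexDist (d₀ : F × ZMod 6) (φ : ℍ ≃ᵢ ℍ) {c : ℝ} (hc : c ≤ sideLength) :
    T.Dev → ℝ :=
  Quot.lift (fun x => if T.AroundVertex d₀ φ x.1.1 x.1.2 then
    min c (dist (x.1.2 (x.2 : ℍ)) (φ (vertex 0))) else c) <| by
    have key : ∀ x y : (F × (ℍ ≃ᵢ ℍ)) × region, T.DevGlued x y →
        (if T.AroundVertex d₀ φ y.1.1 y.1.2 then
          min c (dist (y.1.2 (y.2 : ℍ)) (φ (vertex 0))) else c) ≤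
        (if T.AroundVertex d₀ φ x.1.1 x.1.2 then
          min c (dist (x.1.2 (x.2 : ℍ)) (φ (vertex 0))) else c) := by
      intro x y h
      have hle : (if T.AroundVertex d₀ φ y.1.1 y.1.2 then
          min c (dist (y.1.2 (y.2 : ℍ)) (φ (vertex 0))) else c) ≤ c := by
        split_ifs
        · exact min_le_left _ _
        · exact le_rfl
      by_cases hx : T.AroundVertex d₀ φ x.1.1 x.1.2
      · rw [if_pos hx]
        refine le_min hle ?_
        by_cases hd : dist (x.1.2 (x.2 : ℍ)) (φ (vertex 0)) < sideLength
        · rw [if_pos (hx.of_devGlued h hd), h.apply_eq]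
          exact min_le_right _ _
        · exact hle.trans (hc.trans (not_lt.1 hd))
      · rwa [if_neg hx]
    exact fun x y h => le_antisymm (key y x h.symm) (key x y h)

open Classical in
theorem vertexDist_devPoint (d₀ : F × ZMod 6) (φ : ℍ ≃ᵢ ℍ) {c : ℝ} (hc : c ≤ sideLength) (f : F)
    (g : ℍ ≃ᵢ ℍ) (p : region) : T.vertexDist d₀ φ hc (T.devPoint f g p) =
      if T.AroundVertex d₀ φ f g then min c (dist (g p) (φ (vertex 0))) else c := rfl

theorem edist_vertexDist_le (d₀ : F × ZMod 6) (φ : ℍ ≃ᵢ ℍ) {c : ℝ} (hc : c ≤ sideLength)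
    (x y : T.Dev) : edist (T.vertexDist d₀ φ hc x) (T.vertexDist d₀ φ hc y) ≤ edist x y := by
  classical
  refine T.edist_le_of_devTile (fun f g p q => ?_) x y
  rw [vertexDist_devPoint, vertexDist_devPoint]
  exact edist_truncated_dist_le _ g p q

open Classical in
/-- The distance to a point in the interior of a tile, truncated at `c`. -/
noncomputable def innerDist (f₀ : F) (g₀ : ℍ ≃ᵢ ℍ) (p₀ : ℍ) {c : ℝ}
    (hc : ∀ i, ∀ p ∈ side i, c ≤ dist p p₀) : T.Dev → ℝ :=
  Quot.lift (fun x => if x.1 = (f₀, g₀) then min c (dist (x.1.2 (x.2 : ℍ)) (g₀ p₀)) else c) <| by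
    have key : ∀ x y : (F × (ℍ ≃ᵢ ℍ)) × region, T.DevGlued x y →
        (if x.1 = (f₀, g₀) then min c (dist (x.1.2 (x.2 : ℍ)) (g₀ p₀)) else c) = c := by
      rintro x y ⟨i, j, -, -, hx, -, -⟩
      split_ifs with h
      · rw [h, g₀.dist_eq]
        exact min_eq_left (hc i _ hx)
      · rfl
    exact fun x y h => (key x y h).trans (key y x h.symm).symm

open Classical in
theorem innerDist_devPoint (f₀ : F) (g₀ : ℍ ≃ᵢ ℍ) (p₀ : ℍ) {c : ℝ}
    (hc : ∀ i, ∀ p ∈ side i, c ≤ dist p p₀) (f : F) (g : ℍ ≃ᵢ ℍ) (p : region) :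
    T.innerDist f₀ g₀ p₀ hc (T.devPoint f g p) =
      if (f, g) = (f₀, g₀) then min c (dist (g p) (g₀ p₀)) else c := rfl

theorem edist_innerDist_le (f₀ : F) (g₀ : ℍ ≃ᵢ ℍ) (p₀ : ℍ) {c : ℝ}
    (hc : ∀ i, ∀ p ∈ side i, c ≤ dist p p₀) (x y : T.Dev) :
    edist (T.innerDist f₀ g₀ p₀ hc x) (T.innerDist f₀ g₀ p₀ hc y) ≤ edist x y := by
  classical
  refine T.edist_le_of_devTile (fun f g p q => ?_) x y
  rw [innerDist_devPoint, innerDist_devPoint]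
  exact edist_truncated_dist_le _ g p q

theorem lt_add_of_edist_lt {X : Type*} [PseudoEMetricSpace X] {u : X → ℝ}
    (hu : ∀ x y, edist (u x) (u y) ≤ edist x y) {x y : X} {ε : ℝ}
    (h : edist x y < ENNReal.ofReal ε) : u y < u x + ε := by
  have h1 := (hu x y).trans_lt h
  rw [edist_dist, ENNReal.ofReal_lt_ofReal_iff_of_nonneg dist_nonneg, Real.dist_eq] at h1
  linarith [neg_abs_le (u x - u y)]

/-- The projection is injective on small balls. -/
theorem eq_of_edist_lt {k : ℕ} (hk : 3 ≤ k) (hreg : T.IsRegular k) {e e' : T.Dev}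
    (hp : T.proj e = T.proj e') (h : edist e e' < ENNReal.ofReal (sideLength / 8)) : e = e' := by
  classical
  have hl := sideLength_pos
  obtain ⟨f, g, p, rfl⟩ := T.exists_devPoint e
  obtain ⟨g', rfl⟩ := T.exists_devPoint_eq (f := f) (p := p) hp.symm
  suffices hg : g' = g by rw [hg]
  -- Far from all sides, the truncated distance to the point itself separates the placements of its
  -- tile. Otherwise a vertex is within ℓ/8 + ℓ/2 = 5ℓ/8, and the distance to it, truncated at 5ℓ/8
  -- + ℓ/8, is used.
  by_cases hc : ∀ i, ∀ q ∈ side i, sideLength / 8 ≤ dist q p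
  · have h1 := lt_add_of_edist_lt (T.edist_innerDist_le f g p hc) h
    rw [innerDist_devPoint, innerDist_devPoint, if_pos rfl, dist_self,
      min_eq_right (show (0 : ℝ) ≤ sideLength / 8 by positivity), zero_add] at h1
    by_contra hne
    rw [if_neg (by simpa using hne)] at h1
    exact lt_irrefl _ h1
  · push Not at hc
    obtain ⟨i, q, hq, hqp⟩ := hc
    obtain ⟨i₀, hi₀⟩ : ∃ i₀, dist p.1 (vertex i₀) < 5 / 8 * sideLength := by
      have h0 := dist_add_dist_of_mem_side hq
      rw [dist_comm] at hqp
      rcases le_total (dist (vertex i) q) (dist q (vertex (i + 1))) with hle | hle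
      · refine ⟨i, (dist_triangle _ q _).trans_lt ?_⟩
        rw [dist_comm q]
        linarith
      · refine ⟨i + 1, (dist_triangle _ q _).trans_lt ?_⟩
        linarith
    have hc : 3 / 4 * sideLength ≤ sideLength := by linarith
    have h1 := lt_add_of_edist_lt (T.edist_vertexDist_le (f, i₀) (g * rot i₀) hc) h
    have ha : T.AroundVertex (f, i₀) (g * rot i₀) f g := ⟨0, i₀, rfl, by simp⟩
    have hv : (g * rot i₀) (vertex 0) = g (vertex i₀) := by rw [mul_apply, rot_vertex_zero]
    rw [vertexDist_devPoint, vertexDist_devPoint, if_pos ha, hv, g.dist_eq] at h1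
    have h2 : min (3 / 4 * sideLength) (dist p.1 (vertex i₀)) < 5 / 8 * sideLength :=
      (min_le_right _ _).trans_lt hi₀
    have ha' : T.AroundVertex (f, i₀) (g * rot i₀) f g' := by
      by_contra hne
      rw [if_neg hne] at h1
      linarith
    rw [if_pos ha'] at h1
    obtain ⟨m, i₁, hm, hg', hv'⟩ := ha'.exists_vertex
    rw [← hv, ← hv', g'.dist_eq] at h1
    have h3 : dist p.1 (vertex i₁) < 3 / 4 * sideLength := by
      rcases min_lt_iff.1 (h1.trans (show _ < 3 / 4 * sideLength by linarith)) with h | h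
      · exact absurd h (lt_irrefl _)
      · exact h
    have h4 : dist (vertex i₀) (vertex i₁) < 3 / 2 * sideLength := by
      refine (dist_triangle _ p.1 _).trans_lt ?_
      rw [dist_comm _ p.1]
      linarith
    -- Both placements have a corner at the vertex. The two corners are less than 5ℓ/8 + 3ℓ/4 < 3ℓ/2
    -- apart. If they are the same corner, the rotation between the placements is a power of a full
    -- turn; if they are adjacent, an edge would be a loop.
    rcases eq_or_adjacent_of_dist_lt h4 with rfl | rfl | rfl
    · obtain ⟨n, rfl⟩ := T.four_dvd_of_spin_iterate hm
      rw [pow_mul, quarterTurn_pow_four, one_pow, mul_one] at hg'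
      exact mul_right_cancel hg'
    · exact absurd hm (T.spin_iterate_ne_next hk hreg (f, i₀) m)
    · have hper : T.spin^[3 * m] (f, i₁) = (f, i₁ + 1) := by
        rw [← hm, ← Function.iterate_add_apply, show 3 * m + m = 4 * m by ring,
          Function.iterate_mul, Function.iterate_fixed (T.spin_iterate_four _)]
      exact absurd hper (T.spin_iterate_ne_next hk hreg (f, i₁) _)

end HexTessellation

/-! ### Lifting homotopies along a map that is injective on small balls -/

section Monodromy

variable {E X : Type*} [PseudoEMetricSpace E] [PseudoEMetricSpace X]

/-- A grid of points of `X` with small meshes, constant on three sides, lifts to a grid which is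
constant on the fourth side. -/
theorem eq_of_grid {π : E → X} {ε : ℝ≥0∞}
    (hlift : ∀ e y, edist (π e) y < ε → ∃ e', π e' = y ∧ edist e e' < ε)
    (hinj : ∀ e e', π e = π e' → edist e e' < ε + (ε + (ε + ε)) → e = e')
    {N : ℕ} {x₀ : X} (x : ℕ → ℕ → X) (hx1 : ∀ a b, edist (x a b) (x (a + 1) b) < ε)
    (hx2 : ∀ a b, edist (x a b) (x a (b + 1)) < ε) (hl : ∀ a, x a 0 = x₀) (hr : ∀ a, x a N = x₀)
    (ht : ∀ b, x N b = x₀) (c : ℕ → E) (hc : ∀ b, π (c b) = x 0 b)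
    (hcc : ∀ b, edist (c b) (c (b + 1)) < ε) : c 0 = c N := by
  have hinj' : ∀ e e', π e = π e' → edist e e' < ε → e = e' := fun e e' h h' =>
    hinj e e' h (h'.trans_le le_self_add)
  have key : ∀ a, ∃ c' : ℕ → E, (∀ b, π (c' b) = x a b) ∧ (∀ b, edist (c' b) (c' (b + 1)) < ε) ∧
      c' 0 = c 0 ∧ c' N = c N := by
    intro a
    induction a with
    | zero => exact ⟨c, hc, hcc, rfl, rfl⟩
    | succ a ih =>
      obtain ⟨c', h1, h2, h3, h4⟩ := ih
      have : ∀ b, ∃ e', π e' = x (a + 1) b ∧ edist (c' b) e' < ε := fun b =>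
        hlift _ _ (by rw [h1]; exact hx1 a b)
      choose c'' h5 h6 using this
      refine ⟨c'', h5, fun b => ?_, ?_, ?_⟩
      · obtain ⟨e, he1, he2⟩ := hlift (c'' b) (x (a + 1) (b + 1)) (by rw [h5]; exact hx2 _ _)
        rwa [← hinj e (c'' (b + 1)) (he1.trans (h5 _).symm) ?_]
        refine (edist_triangle _ (c'' b) _).trans_lt ?_
        refine ENNReal.add_lt_add (by rwa [edist_comm]) ?_
        refine (edist_triangle _ (c' b) _).trans_lt ?_
        refine ENNReal.add_lt_add (by rw [edist_comm]; exact h6 b) ?_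
        exact (edist_triangle _ (c' (b + 1)) _).trans_lt (ENNReal.add_lt_add (h2 b) (h6 _))
      · rw [← h3]
        exact (hinj' _ _ (by rw [h1, h5, hl, hl]) (h6 0)).symm
      · rw [← h4]
        exact (hinj' _ _ (by rw [h1, h5, hr, hr]) (h6 N)).symm
  obtain ⟨c', h1, h2, h3, h4⟩ := key N
  have hconst : ∀ b, c' b = c' 0 := by
    intro b
    induction b with
    | zero => rfl
    | succ b ih =>
      rw [← ih]
      exact (hinj' _ _ (by rw [h1, h1, ht, ht]) (h2 b)).symm
  rw [← h3, ← h4, hconst N]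

theorem edist_projIcc_le (N : ℕ) (a : ℕ) :
    edist (Set.projIcc (0 : ℝ) 1 zero_le_one (a / N)) (Set.projIcc 0 1 zero_le_one ((a + 1 : ℕ) / N))
      ≤ (N : ℝ≥0∞)⁻¹ := by
  refine (LipschitzWith.projIcc zero_le_one _ _).trans ?_
  rw [ENNReal.coe_one, one_mul, edist_dist, Real.dist_eq]
  rcases N.eq_zero_or_pos with rfl | hN
  · simp
  · rw [← sub_div, abs_div, Nat.abs_cast]
    push_cast
    rw [sub_add_cancel_left, abs_neg, abs_one, one_div, ENNReal.ofReal_inv_of_pos (by positivity),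
      ENNReal.ofReal_natCast]

/-- A path in `E` is closed if its projection is a null-homotopic closed curve. -/
theorem eq_of_homotopic_refl {π : E → X} (hπ : Continuous π) {ε : ℝ≥0∞} (hε : 0 < ε)
    (hlift : ∀ e y, edist (π e) y < ε → ∃ e', π e' = y ∧ edist e e' < ε)
    (hinj : ∀ e e', π e = π e' → edist e e' < ε + (ε + (ε + ε)) → e = e') {e₀ e₁ : E}
    (γ : Path e₀ e₁) (h : π e₀ = π e₁)
    (hγ : ((γ.map hπ).cast rfl h).Homotopic (Path.refl (π e₀))) : e₀ = e₁ := by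
  obtain ⟨H⟩ := hγ
  obtain ⟨δ₁, hδ₁, h1⟩ := EMetric.uniformContinuous_iff.1
    (CompactSpace.uniformContinuous_of_continuous H.continuous) ε hε
  obtain ⟨δ₂, hδ₂, h2⟩ := EMetric.uniformContinuous_iff.1
    (CompactSpace.uniformContinuous_of_continuous γ.continuous) ε hε
  obtain ⟨N, hN⟩ := ENNReal.exists_inv_nat_lt (lt_min hδ₁ hδ₂).ne'
  have hN0 : (N : ℝ) ≠ 0 := by
    rintro h0
    have : N = 0 := by exact_mod_cast h0
    simp [this] at hN
  set pt : ℕ → unitInterval := fun a => Set.projIcc (0 : ℝ) 1 zero_le_one (a / N) with hpt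
  have pt0 : pt 0 = 0 := by simp [hpt, Set.projIcc_left]
  have ptN : pt N = 1 := by simp [hpt, div_self hN0]
  have hstep : ∀ a, edist (pt a) (pt (a + 1)) < min δ₁ δ₂ := fun a =>
    (edist_projIcc_le N a).trans_lt hN
  have := eq_of_grid (π := π) (ε := ε) (N := N) (x₀ := π e₀) hlift hinj
    (fun a b => H (pt a, pt b))
    (fun a b => h1 (by
      rw [Prod.edist_eq, edist_self, max_eq_left zero_le]
      exact (hstep a).trans_le (min_le_left _ _)))
    (fun a b => h1 (by
      rw [Prod.edist_eq, edist_self, max_eq_right zero_le]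
      exact (hstep b).trans_le (min_le_left _ _)))
    (fun a => by simp [pt0]) (fun a => by simp [ptN]) (fun b => by simp [ptN])
    (fun b => γ (pt b)) (fun b => by simp [pt0])
    (fun b => h2 ((hstep b).trans_le (min_le_right _ _)))
  simpa [pt0, ptN] using this

end Monodromy

/-! ### Lipschitz curves -/

section Reach

variable {E : Type*} [PseudoEMetricSpace E]

/-- There is a curve from `e` to `e'` with unit speed and duration `r`. -/
def Reach (e e' : E) (r : ℝ) : Prop :=
  0 ≤ r ∧ ∃ c : ℝ → E, (∀ s t, edist (c s) (c t) ≤ edist s t) ∧ c 0 = e ∧ c r = e'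

theorem Reach.refl (e : E) : Reach e e 0 :=
  ⟨le_rfl, fun _ => e, fun s t => by simp, rfl, rfl⟩

theorem Reach.symm {e e' : E} {r : ℝ} (h : Reach e e' r) : Reach e' e r := by
  obtain ⟨h0, c, hc, h1, h2⟩ := h
  refine ⟨h0, fun s => c (r - s), fun s t => (hc _ _).trans_eq ?_, by simpa using h2,
    by simpa using h1⟩
  rw [edist_dist, edist_dist, Real.dist_eq, Real.dist_eq, sub_sub_sub_cancel_left, abs_sub_comm]

theorem Reach.trans {e e' e'' : E} {r r' : ℝ} (h : Reach e e' r) (h' : Reach e' e'' r') :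
    Reach e e'' (r + r') := by
  obtain ⟨h0, c, hc, h1, h2⟩ := h
  obtain ⟨h0', c', hc', h1', h2'⟩ := h'
  refine ⟨by positivity, fun s => if s ≤ r then c s else c' (s - r), ?_, by simpa [h0] using h1, ?_⟩
  · have key : ∀ s t, s ≤ r → ¬ t ≤ r → edist (c s) (c' (t - r)) ≤ edist s t := by
      intro s t hs ht
      refine (edist_triangle _ (c r) _).trans ((add_le_add (hc s r)
        ((congrArg (edist · _) (h2.trans h1'.symm)).trans_le (hc' 0 (t - r)))).trans_eq ?_)
      rw [edist_dist, edist_dist, edist_dist, ← ENNReal.ofReal_add dist_nonneg dist_nonneg,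
        Real.dist_eq, Real.dist_eq, Real.dist_eq, abs_of_nonpos (by linarith),
        abs_of_nonpos (by linarith), abs_of_nonpos (by linarith)]
      congr 1
      ring
    intro s t
    by_cases hs : s ≤ r <;> by_cases ht : t ≤ r
    · simpa [hs, ht] using hc s t
    · simpa [hs, ht] using key s t hs ht
    · rw [edist_comm, edist_comm s]
      simpa [hs, ht] using key t s ht hs
    · simp only [hs, ht, if_false]
      refine (hc' _ _).trans_eq ?_
      rw [edist_dist, edist_dist, Real.dist_eq, Real.dist_eq, sub_sub_sub_cancel_right]
  · rcases h0'.eq_or_lt with h | h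
    · subst h
      simp [h2, ← h1', h2']
    · simp [not_le.2 h, h2']

theorem Reach.exists_path {e e' : E} {r : ℝ} (h : Reach e e' r) :
    ∃ γ : Path e e', eVariationOn γ Set.univ ≤ ENNReal.ofReal r := by
  obtain ⟨h0, c, hc, h1, h2⟩ := h
  have hcont : Continuous c := (LipschitzWith.of_edist_le hc).continuous
  refine ⟨⟨⟨fun t => c (r * t), by fun_prop⟩, by simpa using h1, by simpa using h2⟩, ?_⟩
  refine iSup_le ?_
  rintro ⟨n, u, hu, -⟩
  have hmono : ∀ i, ((u i : ℝ)) ≤ u (i + 1) := fun i => hu (Nat.le_succ i)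
  calc ∑ i ∈ Finset.range n, edist (c (r * u (i + 1))) (c (r * u i))
      ≤ ∑ i ∈ Finset.range n, ENNReal.ofReal (r * u (i + 1) - r * u i) := by
        refine Finset.sum_le_sum fun i _ => (hc _ _).trans_eq ?_
        rw [edist_dist, Real.dist_eq, abs_of_nonneg]
        nlinarith [hmono i]
    _ = ENNReal.ofReal (∑ i ∈ Finset.range n, (r * u (i + 1) - r * u i)) := by
        rw [ENNReal.ofReal_sum_of_nonneg]
        intro i _
        nlinarith [hmono i]
    _ ≤ ENNReal.ofReal r := by
        refine ENNReal.ofReal_le_ofReal ?_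
        rw [Finset.sum_range_sub (fun i => r * (u i : ℝ))]
        nlinarith [(u n).2.2, (u 0).2.1, (u 0).2.2, (u n).2.1]

end Reach

/-! ### Essential curves from paths in the development space -/

namespace HexTessellation

variable {F : Type*} (T : HexTessellation F)

open Hexagon

/-- Assuming the segment to lie in the tile avoids convexity of the hexagon; only sides and segments
from the centre are needed. -/
theorem reach_devPoint (f : F) (g : ℍ ≃ᵢ ℍ) (p q : region) (h : seg (p : ℍ) q ⊆ region) :
    Reach (T.devPoint f g p) (T.devPoint f g q) (dist (p : ℍ) q) := by
  obtain ⟨c, h0, h1, hc⟩ := exists_geodesic (p : ℍ) q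
  have hm0 : (0 : ℝ) ∈ Set.Icc 0 (dist (p : ℍ) q) := ⟨le_rfl, dist_nonneg⟩
  have hm1 : dist (p : ℍ) q ∈ Set.Icc 0 (dist (p : ℍ) q) := ⟨dist_nonneg, le_rfl⟩
  have hmem : ∀ t ∈ Set.Icc 0 (dist (p : ℍ) q), c t ∈ region := by
    intro t ht
    refine h ?_
    have e1 : dist (p : ℍ) (c t) = t := by
      conv_lhs => rw [← h0]
      rw [hc 0 hm0 t ht, zero_sub, abs_neg, abs_of_nonneg ht.1]
    have e2 : dist (c t) (q : ℍ) = dist (p : ℍ) q - t := by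
      conv_lhs => rw [← h1]
      rw [hc t ht _ hm1, abs_sub_comm, abs_of_nonneg (sub_nonneg.2 ht.2)]
    simp [seg, e1, e2]
  refine ⟨dist_nonneg, fun t => T.devPoint f g ⟨c (Set.projIcc _ _ dist_nonneg t),
    hmem _ (Set.projIcc _ _ dist_nonneg t).2⟩, fun s t => ?_, ?_, ?_⟩
  · refine (T.edist_devPoint_le f g _ _).trans ?_
    have := LipschitzWith.projIcc (dist_nonneg (x := (p : ℍ)) (y := q)) s t
    rw [ENNReal.coe_one, one_mul] at this
    refine Eq.trans_le ?_ this
    rw [edist_dist, hc _ (Set.projIcc _ _ dist_nonneg s).2 _ (Set.projIcc _ _ dist_nonneg t).2,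
      Subtype.edist_eq, edist_dist, Real.dist_eq]
  · simp [Set.projIcc_left, h0]
  · simp [Set.projIcc_right, h1]

theorem continuous_proj : Continuous T.proj :=
  (LipschitzWith.of_edist_le T.edist_proj_le).continuous

/-- A path in the development space that is not closed, but whose projection is closed, projects
to an essential curve. -/
theorem exists_essential {k : ℕ} (hk : 3 ≤ k) (hreg : T.IsRegular k) {e e' : T.Dev} {r : ℝ}
    (h : Reach e e' r) (hp : T.proj e = T.proj e') (hne : T.develop e ≠ T.develop e') :
    ∃ δ : Path (T.proj e) (T.proj e), MetricSystole.IsEssential δ ∧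
      MetricSystole.length δ ≤ ENNReal.ofReal r := by
  obtain ⟨γ, hγ⟩ := h.exists_path
  have hl := sideLength_pos
  refine ⟨(γ.map T.continuous_proj).cast rfl hp, fun hhom => hne ?_, ?_⟩
  -- Four times ℓ/32 is the radius ℓ/8 of injectivity of the projection.
  · refine congrArg T.develop (eq_of_homotopic_refl T.continuous_proj
      (ε := ENNReal.ofReal (sideLength / 32)) (by positivity) (fun e y => T.exists_lift)
      (fun e e' h h' => T.eq_of_edist_lt hk hreg h (h'.trans_eq ?_)) γ hp hhom)
    rw [← ENNReal.ofReal_add (by positivity) (by positivity),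
      ← ENNReal.ofReal_add (by positivity) (by positivity),
      ← ENNReal.ofReal_add (by positivity) (by positivity)]
    congr 1
    ring
  · refine le_trans ?_ hγ
    refine iSup_mono fun u => Finset.sum_le_sum fun i _ => ?_
    exact T.edist_proj_le _ _

end HexTessellation

/-- A curve through finitely many points which are pairwise far from each other is long. -/
theorem card_mul_le_eVariationOn {α X ι : Type*} [LinearOrder α] [PseudoEMetricSpace X] [Fintype ι]
    (f : α → X) (t : ι → α) {s : ℝ≥0∞} (hs : ∀ a b, a ≠ b → s ≤ edist (f (t a)) (f (t b))) :
    (Fintype.card ι - 1 : ℕ) * s ≤ eVariationOn f Set.univ := by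
  classical
  rcases eq_or_ne s 0 with rfl | hs0
  · simp
  rcases isEmpty_or_nonempty ι with hι | hι
  · simp
  have hinj : Function.Injective t := by
    intro a b hab
    by_contra hne
    have := hs a b hne
    rw [hab, edist_self] at this
    exact hs0 (nonpos_iff_eq_zero.1 this)
  set A : Finset α := Finset.univ.image t with hA
  -- The parameters are distinct, so sorting them gives a subdivision all of whose steps are at
  -- least s.
  have hcard : A.card = Fintype.card ι := by
    rw [hA, Finset.card_image_of_injective _ hinj, Finset.card_univ]
  have hpos : 0 < Fintype.card ι := Fintype.card_pos
  set N := Fintype.card ι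
  set o := A.orderEmbOfFin hcard
  set u : ℕ → α := fun i => if h : i < N then o ⟨i, h⟩ else o ⟨0, hpos⟩ with hu
  have hsep : ∀ i, i + 1 < N → s ≤ edist (f (u (i + 1))) (f (u i)) := by
    intro i hi
    have h1 : u (i + 1) = o ⟨i + 1, hi⟩ := by simp [hu, hi]
    have h2 : u i = o ⟨i, by omega⟩ := by simp [hu, show i < N by omega]
    obtain ⟨a, -, ha⟩ := Finset.mem_image.1 (A.orderEmbOfFin_mem hcard ⟨i + 1, hi⟩)
    obtain ⟨b, -, hb⟩ := Finset.mem_image.1 (A.orderEmbOfFin_mem hcard ⟨i, by omega⟩)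
    rw [h1, h2, ← ha, ← hb]
    refine hs a b ?_
    rintro rfl
    have := (A.orderEmbOfFin hcard).injective (ha.symm.trans hb)
    simp at this
  have hmono : MonotoneOn u (Set.Iic (N - 1)) := by
    intro i hi j hj hij
    rw [Set.mem_Iic] at hi hj
    have h1 : u i = o ⟨i, by omega⟩ := by simp [hu, show i < N by omega]
    have h2 : u j = o ⟨j, by omega⟩ := by simp [hu, show j < N by omega]
    rw [h1, h2]
    exact o.monotone hij
  refine le_trans ?_ (eVariationOn.sum_le_of_monotoneOn_Iic (f := f) (n := N - 1) hmono
    fun i _ => Set.mem_univ _)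
  calc ((N - 1 : ℕ) : ℝ≥0∞) * s = ∑ _i ∈ Finset.range (N - 1), s := by simp
    _ ≤ _ := Finset.sum_le_sum fun i hi => hsep i (by rw [Finset.mem_range] at hi; omega)

namespace HexTessellation

variable {F : Type*} (T : HexTessellation F)

open Hexagon

/-! ### The curves of the tessellation -/

theorem straight_eq_spin (d : F × ZMod 6) : T.straight d = T.spin^[3] (next d) := by
  rw [spin_iterate_three, straight]

theorem straight_injective : Function.Injective T.straight := fun _ _ h =>
  next_injective (T.glue_injective (next_injective h))

theorem spin_straight (d : F × ZMod 6) : T.spin (T.straight d) = next d := T.spin_next_glue _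

theorem straight_glue_straight (d : F × ZMod 6) : T.straight (T.glue (T.straight d)) = T.glue d := by
  rw [straight_eq_spin, ← spin_iterate_three, straight_eq_spin, ← Function.iterate_add_apply,
    ← Function.iterate_add_apply, show 3 + (3 + 3) = 1 + 4 + 4 from rfl,
    Function.iterate_add_apply, spin_iterate_four, Function.iterate_add_apply, spin_iterate_four,
    Function.iterate_one, spin_next]

theorem even_straight (d : F × ZMod 6) : Even (T.straight d).2 ↔ Even d.2 := by
  rw [straight, even_next, T.glue_colour, even_next, not_not]

theorem even_straight_iterate (d : F × ZMod 6) (n : ℕ) : Even (T.straight^[n] d).2 ↔ Even d.2 := by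
  induction n with
  | zero => rfl
  | succ n ih => rw [Function.iterate_succ_apply', even_straight, ih]

/-- A curve passes through each of its edges in one direction only. -/
theorem straight_iterate_ne_glue (n : ℕ) (d : F × ZMod 6) : T.straight^[n] d ≠ T.glue d := by
  induction n using Nat.twoStepInduction generalizing d with
  | zero => exact (T.glue_ne d).symm
  -- The curve would turn back at a vertex, making two rotations about it trivial.
  | one =>
    intro h
    rw [Function.iterate_one, straight_eq_spin, ← spin_next] at h
    have h2 : T.spin^[2] (next d) = next d := by
      have := congrArg T.spin^[3] h
      rw [← Function.iterate_add_apply, show 3 + 3 = 2 + 4 from rfl, Function.iterate_add_apply,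
        spin_iterate_four, ← Function.iterate_succ_apply T.spin 3, spin_iterate_four] at this
      exact this
    exact absurd (T.four_dvd_of_spin_iterate h2) (by norm_num)
  -- Removing one step at either end of the walk leaves a walk of the same kind that is shorter by
  -- two.
  | more n ih _ =>
    intro h
    refine ih (T.straight d) ?_
    rw [Function.iterate_succ_apply', Function.iterate_succ_apply, ← straight_glue_straight] at h
    exact T.straight_injective h

theorem straight_iterate_ne_glue_straight_iterate (a b : ℕ) (d : F × ZMod 6) :
    T.straight^[a] d ≠ T.glue (T.straight^[b] d) := by
  intro h
  rcases le_total b a with hab | hab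
  · obtain ⟨c, rfl⟩ := Nat.exists_eq_add_of_le' hab
    rw [Function.iterate_add_apply] at h
    exact T.straight_iterate_ne_glue c _ h
  · obtain ⟨c, rfl⟩ := Nat.exists_eq_add_of_le' hab
    have h' := (congrArg T.glue h).symm
    rw [glue_glue, Function.iterate_add_apply] at h'
    exact T.straight_iterate_ne_glue c _ h'

theorem edge_eq_iff {d d' : F × ZMod 6} : T.edge d = T.edge d' ↔ d = d' ∨ d = T.glue d' := by
  rw [edge, edge, Sym2.eq_iff]
  constructor
  · rintro (h | h)
    · exact Or.inl h.1
    · exact Or.inr h.1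
  · rintro (rfl | rfl)
    · exact Or.inl ⟨rfl, rfl⟩
    · exact Or.inr ⟨rfl, T.glue_glue _⟩

/-- A curve never runs back along one of its edges, so its edges correspond to the sides in one
period of `straight`. -/
theorem minimalPeriod_straight [Finite F] {k : ℕ} (hreg : T.IsRegular k) (d : F × ZMod 6) :
    Function.minimalPeriod T.straight d = k := by
  have hper : 0 < Function.minimalPeriod T.straight d :=
    Function.minimalPeriod_pos_of_mem_periodicPts (T.straight_injective.mem_periodicPts d)
  set p := Function.minimalPeriod T.straight d with hp
  have hinj : Set.InjOn (fun n : ℕ => T.edge (T.straight^[n] d)) (Finset.range p : Set ℕ) := by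
    intro a ha b hb hab
    rw [Finset.coe_range, Set.mem_Iio] at ha hb
    rcases T.edge_eq_iff.1 hab with h | h
    · exact (Function.iterate_eq_iterate_iff_of_lt_minimalPeriod ha hb).1 h
    · exact absurd h (T.straight_iterate_ne_glue_straight_iterate a b d)
  have himg : T.curveEdges d = (fun n : ℕ => T.edge (T.straight^[n] d)) '' (Finset.range p : Set ℕ) := by
    ext x
    constructor
    · rintro ⟨n, rfl⟩
      refine ⟨n % p, by simpa using Nat.mod_lt n hper, ?_⟩
      simp only [hp, Function.iterate_mod_minimalPeriod_eq]
    · rintro ⟨n, -, rfl⟩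
      exact ⟨n, rfl⟩
  have := hreg d
  rwa [himg, hinj.ncard_image, Set.ncard_coe_finset, Finset.card_range] at this

/-! ### Points on different edges are far from each other -/

theorem glued_near_edge {d : F × ZMod 6} {p : ℍ} (hp : p ∈ side d.2) {s : ℝ} (hs : 0 ≤ s)
    (h1 : s ≤ dist (vertex d.2) p) (h2 : s ≤ dist p (vertex (d.2 + 1))) {x y : F × region}
    (h : T.Glued x y) (hx : x.1 = d.1) (hd : dist (x.2 : ℍ) p < s) :
    y.1 = (T.glue d).1 ∧ dist (y.2 : ℍ) (glueIso (T.glue d).2 d.2 p) = dist (x.2 : ℍ) p := by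
  obtain ⟨i, j, hg, hx', hy, hdist⟩ := h.symm
  have hj : j = d.2 := by
    by_contra hne
    rw [dist_comm] at hd
    exact absurd (le_dist_of_mem_side hne hp hy hs h1 h2) (not_le.2 hd)
  have hd' : T.glue d = (y.1, i) := by
    rw [show d = (x.1, j) from Prod.ext hx.symm hj.symm, ← hg, glue_glue]
  rw [hd']
  refine ⟨rfl, ?_⟩
  rw [← hj, eq_glueIso hx' hy hdist, (glueIso i j).dist_eq]

open Classical in
/-- The distance to the point `p` of the side `d`, truncated at `s`. -/
noncomputable def edgePointDist (d : F × ZMod 6) {p : ℍ} (hp : p ∈ side d.2) {s : ℝ} (hs : 0 ≤ s)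
    (h1 : s ≤ dist (vertex d.2) p) (h2 : s ≤ dist p (vertex (d.2 + 1))) : T.Surface → ℝ :=
  Quot.lift (fun x => min s (min (if x.1 = d.1 then dist (x.2 : ℍ) p else s)
    (if x.1 = (T.glue d).1 then dist (x.2 : ℍ) (glueIso (T.glue d).2 d.2 p) else s))) <| by
    have key : ∀ x y : F × region, T.Glued x y →
        min s (min (if y.1 = d.1 then dist (y.2 : ℍ) p else s)
          (if y.1 = (T.glue d).1 then dist (y.2 : ℍ) (glueIso (T.glue d).2 d.2 p) else s)) ≤
        min s (min (if x.1 = d.1 then dist (x.2 : ℍ) p else s)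
          (if x.1 = (T.glue d).1 then dist (x.2 : ℍ) (glueIso (T.glue d).2 d.2 p) else s)) := by
      intro x y h
      refine le_min (min_le_left _ _) (le_min ?_ ?_)
      · by_cases hx : x.1 = d.1
        · rw [if_pos hx]
          by_cases hd : dist (x.2 : ℍ) p < s
          · obtain ⟨k1, k2⟩ := T.glued_near_edge hp hs h1 h2 h hx hd
            rw [if_pos k1, k2]
            exact (min_le_right _ _).trans (min_le_right _ _)
          · exact (min_le_left _ _).trans (not_lt.1 hd)
        · rw [if_neg hx]
          exact min_le_left _ _
      · by_cases hx : x.1 = (T.glue d).1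
        · rw [if_pos hx]
          by_cases hd : dist (x.2 : ℍ) (glueIso (T.glue d).2 d.2 p) < s
          · obtain ⟨k1, k2⟩ := T.glued_near_edge (d := T.glue d) (glueIso_mem_side hp) hs
              (by rw [← glueIso_vertex_add_one _ d.2, (glueIso _ _).dist_eq, dist_comm]; exact h2)
              (by rw [← glueIso_vertex _ d.2, (glueIso _ _).dist_eq, dist_comm]; exact h1) h hx hd
            rw [glue_glue] at k1 k2
            rw [← mul_apply, ← glueIso_inv d.2, mul_inv_cancel, one_apply] at k2
            rw [if_pos k1, k2, ← glueIso_inv d.2]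
            exact (min_le_right _ _).trans (min_le_left _ _)
          · exact (min_le_left _ _).trans (not_lt.1 hd)
        · rw [if_neg hx]
          exact min_le_left _ _
    exact fun x y h => le_antisymm (key y x h.symm) (key x y h)

open Classical in
theorem edgePointDist_point (d : F × ZMod 6) {p : ℍ} (hp : p ∈ side d.2) {s : ℝ} (hs : 0 ≤ s)
    (h1 : s ≤ dist (vertex d.2) p) (h2 : s ≤ dist p (vertex (d.2 + 1))) (f : F) (q : region) :
    T.edgePointDist d hp hs h1 h2 (T.point f q) =
      min s (min (if f = d.1 then dist (q : ℍ) p else s)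
        (if f = (T.glue d).1 then dist (q : ℍ) (glueIso (T.glue d).2 d.2 p) else s)) := rfl

theorem edist_edgePointDist_le (d : F × ZMod 6) {p : ℍ} (hp : p ∈ side d.2) {s : ℝ} (hs : 0 ≤ s)
    (h1 : s ≤ dist (vertex d.2) p) (h2 : s ≤ dist p (vertex (d.2 + 1))) (x y : T.Surface) :
    edist (T.edgePointDist d hp hs h1 h2 x) (T.edgePointDist d hp hs h1 h2 y) ≤ edist x y := by
  classical
  refine T.edist_le_of_tile (fun f q q' => ?_) x y
  rw [edgePointDist_point, edgePointDist_point, edist_dist, edist_dist, Real.dist_eq]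
  refine ENNReal.ofReal_le_ofReal ?_
  have aux : ∀ (P : Prop) [Decidable P] (a : ℍ),
      |(if P then dist (q : ℍ) a else s) - (if P then dist (q' : ℍ) a else s)|
        ≤ dist (q : ℍ) (q' : ℍ) := by
    intro P _ a
    split_ifs
    · exact abs_dist_sub_le _ _ _
    · simp
  refine (abs_min_sub_min_le_max _ _ _ _).trans (max_le (by simp) ?_)
  exact (abs_min_sub_min_le_max _ _ _ _).trans (max_le (aux _ _) (aux _ _))

/-- The truncated distance to p is Lipschitz and below s only near one of the two representatives of
p, where no other side of the tile comes. -/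
theorem eq_or_eq_glue_of_edist_lt {d d' : F × ZMod 6} {p p' : region} (hp : (p : ℍ) ∈ side d.2)
    (hp' : (p' : ℍ) ∈ side d'.2) {s : ℝ} (hs : 0 ≤ s) (h1 : s ≤ dist (vertex d.2) p)
    (h2 : s ≤ dist (p : ℍ) (vertex (d.2 + 1)))
    (h : edist (T.point d.1 p) (T.point d'.1 p') < ENNReal.ofReal s) :
    (d' = d ∧ dist (p' : ℍ) p < s) ∨ d' = T.glue d := by
  classical
  have hlt := lt_add_of_edist_lt (T.edist_edgePointDist_le d hp hs h1 h2) h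
  rw [edgePointDist_point, edgePointDist_point, if_pos rfl, dist_self] at hlt
  have h0 : min s (min 0 (if d.1 = (T.glue d).1 then
      dist (p : ℍ) (glueIso (T.glue d).2 d.2 p) else s)) ≤ 0 :=
    (min_le_right _ _).trans (min_le_left _ _)
  have hlt' := hlt.trans_le (show _ ≤ s by linarith)
  rcases min_lt_iff.1 hlt' with h | h
  · exact absurd h (lt_irrefl _)
  rcases min_lt_iff.1 h with h | h
  · split_ifs at h with hf
    · refine Or.inl ⟨Prod.ext hf ?_, h⟩
      by_contra hne
      rw [dist_comm] at h
      exact absurd (le_dist_of_mem_side hne hp hp' hs h1 h2) (not_le.2 h)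
    · exact absurd h (lt_irrefl _)
  · split_ifs at h with hf
    · refine Or.inr (Prod.ext hf ?_)
      by_contra hne
      rw [dist_comm] at h
      refine absurd (le_dist_of_mem_side hne (glueIso_mem_side hp) hp' hs ?_ ?_) (not_le.2 h)
      · rw [← glueIso_vertex_add_one _ d.2, (glueIso _ _).dist_eq, dist_comm]; exact h2
      · rw [← glueIso_vertex _ d.2, (glueIso _ _).dist_eq, dist_comm]; exact h1
    · exact absurd h (lt_irrefl _)

/-- A closed curve that covers a curve of the tessellation is at least as long as this curve. -/
theorem le_length_of_range_eq [Finite F] {k : ℕ} (hk : 3 ≤ k) (hreg : T.IsRegular k)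
    {r : F × ZMod 6} {x : T.Surface} (γ : Path x x) (hγ : Set.range γ = T.curveSet r) :
    ENNReal.ofReal (k * sideLength) ≤ MetricSystole.length γ := by
  have hl := sideLength_pos
  -- On each of the k edges take M + 1 interior points at spacing s = ℓ/(M + 2). Leaving out the
  -- vertices keeps each sample at distance at least s from the ends of its edge, hence from all
  -- other samples. The bound tends to kℓ as M grows.
  have hsub : ∀ M : ℕ, ((k * (M + 1) - 1 : ℕ) : ℝ≥0∞) * ENNReal.ofReal (sideLength / (M + 2 : ℕ)) ≤
      MetricSystole.length γ := by
    intro M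
    set s := sideLength / (M + 2 : ℕ) with hs
    have hs0 : 0 < s := by positivity
    have hsM : s * (M + 2 : ℕ) = sideLength := by rw [hs]; field_simp
    have hpt : ∀ a : Fin k × Fin (M + 1), ∃ p : region,
        (p : ℍ) ∈ side (T.straight^[a.1] r).2 ∧
          dist (vertex (T.straight^[a.1] r).2) p = (a.2 + 1 : ℕ) * s := by
      intro a
      have ha : ((a.2 + 1 : ℕ) : ℝ) ≤ (M + 2 : ℕ) := by exact_mod_cast (by omega)
      obtain ⟨p, hp, hd⟩ := exists_mem_seg (a := vertex (T.straight^[a.1] r).2)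
        (b := vertex ((T.straight^[a.1] r).2 + 1)) (t := (a.2 + 1 : ℕ) * s)
        ⟨by positivity, by rw [dist_vertex_add_one, ← hsM]; nlinarith⟩
      exact ⟨⟨p, side_subset_region _ hp⟩, hp, hd⟩
    choose P hP hPd using hpt
    have hmem : ∀ a : Fin k × Fin (M + 1), ∃ t, γ t = T.point (T.straight^[a.1] r).1 (P a) := by
      intro a
      have : T.point (T.straight^[a.1] r).1 (P a) ∈ Set.range γ := by
        rw [hγ]
        exact Set.mem_iUnion.2 ⟨a.1, P a, hP a, rfl⟩
      exact this
    choose t ht using hmem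
    have := card_mul_le_eVariationOn γ t (s := ENNReal.ofReal s) (fun a b hab => by
      by_contra! hlt
      rw [ht, ht] at hlt
      have e1 : s ≤ dist (vertex (T.straight^[a.1] r).2) (P a) := by
        rw [hPd]
        push_cast
        nlinarith [mul_nonneg (Nat.cast_nonneg (α := ℝ) a.2) hs0.le]
      have e2 : s ≤ dist (P a : ℍ) (vertex ((T.straight^[a.1] r).2 + 1)) := by
        have h0 := dist_add_dist_of_mem_side (hP a)
        rw [hPd, ← hsM] at h0
        have ha : ((a.2 + 1 : ℕ) : ℝ) + 1 ≤ (M + 2 : ℕ) := by exact_mod_cast (by omega)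
        nlinarith
      rcases T.eq_or_eq_glue_of_edist_lt (hP a) (hP b) hs0.le e1 e2 hlt with ⟨h, hd⟩ | h
      · have hper := T.minimalPeriod_straight hreg r
        have h1 : (b.1 : ℕ) = a.1 := (Function.iterate_eq_iterate_iff_of_lt_minimalPeriod
          (by rw [hper]; exact b.1.2) (by rw [hper]; exact a.1.2)).1 h
        refine hab (Prod.ext (Fin.ext h1.symm) (Fin.ext ?_))
        have h2 := (abs_dist_sub_le (P b : ℍ) (P a : ℍ) (vertex (T.straight^[a.1] r).2)).trans_lt hd
        rw [dist_comm _ (vertex (T.straight^[a.1] r).2), dist_comm _ (vertex (T.straight^[a.1] r).2),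
          hPd a, ← h, hPd b, ← sub_mul, abs_mul, abs_of_pos hs0] at h2
        have h3 : |((b.2 + 1 : ℕ) : ℝ) - (a.2 + 1 : ℕ)| < 1 := by
          by_contra! hge
          nlinarith
        have h4 : |((b.2 + 1 : ℕ) : ℤ) - (a.2 + 1 : ℕ)| < 1 := by exact_mod_cast h3
        rw [Int.abs_lt_one_iff] at h4
        omega
      · exact T.straight_iterate_ne_glue_straight_iterate _ _ _ h)
    rw [Fintype.card_prod, Fintype.card_fin, Fintype.card_fin] at this
    exact this
  by_contra! hlt
  set L := (MetricSystole.length γ).toReal with hL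
  have htop : MetricSystole.length γ ≠ ⊤ := ne_top_of_lt hlt
  have hLlt : L < k * sideLength := (ENNReal.lt_ofReal_iff_toReal_lt htop).1 hlt
  -- Since k(M + 1) - 1 = k(M + 2) - (k + 1), a length L < kℓ would give (kℓ - L)(M + 2) ≤ (k + 1)ℓ.
  obtain ⟨M, hM⟩ := exists_nat_gt ((k + 1) * sideLength / (k * sideLength - L))
  have h1 := hsub M
  rw [← ENNReal.ofReal_natCast, ← ENNReal.ofReal_mul (Nat.cast_nonneg _),
    ENNReal.ofReal_le_iff_le_toReal htop, ← hL, Nat.cast_sub (by nlinarith), ← mul_div_assoc,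
    div_le_iff₀ (by positivity)] at h1
  rw [div_lt_iff₀ (by linarith)] at hM
  push_cast at h1
  nlinarith

/-- There are no short essential curves. -/
theorem develop_eq_of_reach [Finite F] [Nonempty F] {k : ℕ} (hk : 3 ≤ k) (hreg : T.IsRegular k)
    (hsys : MetricSystole.systoles T.Surface = T.curves) {e e' : T.Dev} {r : ℝ}
    (h : Reach e e' r) (hr : r < k * sideLength) (hp : T.proj e = T.proj e') :
    T.develop e = T.develop e' := by
  by_contra hne
  obtain ⟨δ, hδ, hlen⟩ := T.exists_essential hk hreg h hp hne
  obtain ⟨f⟩ := ‹Nonempty F›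
  have hmem : T.curveSet (f, 0) ∈ MetricSystole.systoles T.Surface := by
    rw [hsys]
    exact ⟨(f, 0), rfl⟩
  obtain ⟨x, γ, ⟨-, -, hmin⟩, hγ⟩ := hmem
  have h1 := T.le_length_of_range_eq hk hreg γ hγ.symm
  have h2 := (h1.trans (hmin _ δ hδ)).trans hlen
  have hl := sideLength_pos
  have h3 : 0 < (k : ℝ) * sideLength := by
    have : (0 : ℝ) < k := by exact_mod_cast (by omega)
    positivity
  exact absurd h2 (not_le.2 ((ENNReal.ofReal_lt_ofReal_iff h3).2 hr))

end HexTessellation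

namespace HexTessellation

variable {F : Type*} (T : HexTessellation F)

open Hexagon

/-! ### Vertices -/

/-- The starting vertex of the side `d`. -/
noncomputable def corner (d : F × ZMod 6) : T.Surface := T.point d.1 ⟨vertex d.2, vertex_mem_region _⟩

/-- The starting vertex of the side `d`, where `d` is placed in the hyperbolic plane as the image
under `φ` of the side with number `0`. -/
noncomputable def devCorner (d : F × ZMod 6) (φ : ℍ ≃ᵢ ℍ) : T.Dev :=
  T.devPoint d.1 (φ * (rot d.2)⁻¹) ⟨vertex d.2, vertex_mem_region _⟩

theorem develop_devCorner (d : F × ZMod 6) (φ : ℍ ≃ᵢ ℍ) :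
    T.develop (T.devCorner d φ) = φ (vertex 0) := by
  rw [devCorner, develop_devPoint, mul_apply, ← rot_neg, rot_vertex, neg_add_cancel]

theorem devCorner_add (d : F × ZMod 6) (j : ZMod 6) (φ : ℍ ≃ᵢ ℍ) :
    T.devCorner (d.1, d.2 + j) (φ * rot j) =
      T.devPoint d.1 (φ * (rot d.2)⁻¹) ⟨vertex (d.2 + j), vertex_mem_region _⟩ := by
  simp only [devCorner]
  rw [show φ * rot j * (rot (d.2 + j))⁻¹ = φ * (rot d.2)⁻¹ by
    rw [rot_add, mul_inv_rev]; simp [mul_assoc]]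

/-- Placements are recorded relative to the side, so that crossing an edge is always the same half
turn, whatever the numbers of the sides. -/
theorem devCorner_eq_next_glue (d : F × ZMod 6) (φ : ℍ ≃ᵢ ℍ) :
    T.devCorner d φ = T.devCorner (next (T.glue d)) (φ * halfTurn * turn) := by
  have h := T.devCorner_add (T.glue d) 1 (φ * halfTurn)
  rw [rot_one] at h
  refine Eq.trans ?_ h.symm
  refine Quot.sound ⟨d.2, (T.glue d).2, rfl, ?_, vertex_mem_side _, vertex_add_one_mem_side _, ?_⟩
  · simp [glueIso, mul_assoc]
  · simp

/-- The product defining `translation` follows the steps next, glue, next of `straight`: going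
straight on in the surface is translating along a line in the plane. -/
theorem devCorner_next (d : F × ZMod 6) (φ : ℍ ≃ᵢ ℍ) :
    T.devCorner (next d) (φ * turn) = T.devCorner (T.straight d) (φ * translation) := by
  rw [devCorner_eq_next_glue, straight, translation]
  simp only [mul_assoc]

theorem corner_next (d : F × ZMod 6) : T.corner (next d) = T.corner (T.straight d) :=
  congrArg T.proj (T.devCorner_next d 1)

theorem reach_next (d : F × ZMod 6) (φ : ℍ ≃ᵢ ℍ) :
    Reach (T.devCorner d φ) (T.devCorner (next d) (φ * turn)) sideLength := by
  have h := T.devCorner_add d 1 φ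
  rw [rot_one] at h
  have h' : T.devCorner (next d) (φ * turn) = _ := h
  rw [h', ← dist_vertex_add_one d.2]
  exact T.reach_devPoint d.1 _ _ _ (side_subset_region d.2)

theorem reach_straight (d : F × ZMod 6) (φ : ℍ ≃ᵢ ℍ) :
    Reach (T.devCorner d φ) (T.devCorner (T.straight d) (φ * translation)) sideLength := by
  rw [← devCorner_next]
  exact T.reach_next d φ

theorem reach_straight_iterate (d : F × ZMod 6) (φ : ℍ ≃ᵢ ℍ) (n : ℕ) :
    Reach (T.devCorner d φ) (T.devCorner (T.straight^[n] d) (φ * translation ^ n))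
      (n * sideLength) := by
  induction n with
  | zero => simpa using Reach.refl (T.devCorner d φ)
  | succ n ih =>
    rw [Function.iterate_succ_apply', pow_succ, ← mul_assoc]
    push_cast
    rw [add_mul, one_mul]
    exact ih.trans (T.reach_straight _ _)

/-- The way along a long diagonal of a tile. -/
theorem reach_diagonal (d : F × ZMod 6) (φ : ℍ ≃ᵢ ℍ) : ∃ s < 2 * sideLength,
    Reach (T.devCorner d φ) (T.devCorner (next (next (next d))) (φ * rot 2 * turn)) s := by
  have h := T.devCorner_add d 3 φ
  have e1 : (d.1, d.2 + 3) = next (next (next d)) := by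
    simp only [next, add_assoc]
    rfl
  have e2 : rot 3 = rot 2 * turn := by
    rw [← rot_one, ← rot_add]
    rfl
  rw [e1, e2, ← mul_assoc] at h
  rw [h]
  refine ⟨dist UpperHalfPlane.I (vertex d.2) + dist UpperHalfPlane.I (vertex (d.2 + 3)), ?_, ?_⟩
  · linarith [dist_I_vertex_lt d.2, dist_I_vertex_lt (d.2 + 3)]
  · exact (T.reach_devPoint d.1 (φ * (rot d.2)⁻¹) ⟨_, I_mem_region⟩ ⟨_, vertex_mem_region d.2⟩
      (seg_I_vertex_subset_region d.2)).symm.trans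
      (T.reach_devPoint d.1 (φ * (rot d.2)⁻¹) ⟨_, I_mem_region⟩ ⟨_, vertex_mem_region (d.2 + 3)⟩
      (seg_I_vertex_subset_region (d.2 + 3)))

theorem vertex_mem_side_iff {i j : ZMod 6} : vertex i ∈ side j ↔ i = j ∨ i = j + 1 := by
  constructor
  · intro h
    by_contra! hne
    have := sideLength_le_dist h hne.1 hne.2
    rw [dist_self] at this
    exact absurd sideLength_pos (not_lt.2 this)
  · rintro (rfl | rfl)
    · exact vertex_mem_side _
    · exact vertex_add_one_mem_side _

/-- A property of points of tiles which is preserved by the gluing. -/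
theorem of_point_eq {P : F → region → Prop}
    (hP : ∀ x y : F × region, T.Glued x y → P x.1 x.2 → P y.1 y.2) {f f' : F} {p p' : region}
    (h : T.point f p = T.point f' p') (hp : P f p) : P f' p' := by
  have key : ∀ x y, T.Glued x y → P x.1 x.2 = P y.1 y.2 := fun x y hxy =>
    propext ⟨hP x y hxy, hP y x hxy.symm⟩
  exact (congrArg (Quot.lift (fun x : F × region => P x.1 x.2) key) h).mp hp

/-- The representatives of a vertex are the corners around it. -/
theorem exists_spin_of_corner_eq {d : F × ZMod 6} {f : F} {p : region}
    (h : T.corner d = T.point f p) :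
    ∃ (m : ℕ) (i : ZMod 6), T.spin^[m] d = (f, i) ∧ (p : ℍ) = vertex i := by
  refine T.of_point_eq (P := fun f p => ∃ (m : ℕ) (i : ZMod 6), T.spin^[m] d = (f, i) ∧
    (p : ℍ) = vertex i) ?_ h ⟨0, d.2, rfl, rfl⟩
  rintro x y ⟨i', j, hg, hx, hy, hd⟩ ⟨m, i, hm, hi⟩
  rw [hi, vertex_mem_side_iff] at hx
  rcases hx with rfl | rfl
  · refine ⟨m + 3, j + 1, ?_, ?_⟩
    · rw [add_comm, Function.iterate_add_apply, hm, spin_iterate_three, hg]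
      rfl
    · rw [hi, dist_self] at hd
      exact (dist_eq_zero.1 hd.symm).symm
  · refine ⟨m + 1, j, ?_, ?_⟩
    · rw [Function.iterate_succ_apply', hm, spin, ← hg]
      simp
    · rw [hi, dist_vertex_add_one] at hd
      have := dist_add_dist_of_mem_side hy
      rw [dist_comm _ (vertex (j + 1)), ← hd] at this
      exact (dist_eq_zero.1 (by linarith)).symm

theorem exists_spin_of_corner_eq_corner {d d' : F × ZMod 6} (h : T.corner d = T.corner d') :
    ∃ m, d' = T.spin^[m] d := by
  obtain ⟨m, i, hm, hi⟩ := T.exists_spin_of_corner_eq h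
  exact ⟨m, by rw [hm, ← vertex_injective hi]⟩

theorem eq_spin_of_corner_eq {d d' : F × ZMod 6} (h : T.corner d = T.corner d') (hd : Even d.2)
    (hd' : ¬ Even d'.2) : d' = T.spin d ∨ d' = T.spin^[3] d := by
  obtain ⟨m, rfl⟩ := T.exists_spin_of_corner_eq_corner h
  rw [even_spin_iterate] at hd'
  have hodd : ¬ Even m := by tauto
  rw [← Function.iterate_mod_minimalPeriod_eq, minimalPeriod_spin]
  have hm : m % 4 = 1 ∨ m % 4 = 3 := by
    rw [Nat.even_iff] at hodd
    omega
  rcases hm with hm | hm <;> simp [hm]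

/-- The way along an edge that is perpendicular to the side `d`, on one side or the other. -/
theorem exists_reach_perpendicular {d b : F × ZMod 6} (h : b = T.spin d ∨ b = T.spin^[3] d)
    (φ : ℍ ≃ᵢ ℍ) : ∃ e z, Reach (T.devCorner d φ) e sideLength ∧ T.proj e = T.corner (next b) ∧
      T.develop e = φ z ∧ axisForm z ≠ 0 := by
  have hpos : 0 < √2 * √3 := by positivity
  rcases h with rfl | rfl
  · refine ⟨T.devCorner (next (T.spin d)) (φ * turn⁻¹ * halfTurn * turn), turn⁻¹ (vertex 0),
      ?_, rfl, ?_, ?_⟩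
    · have h := T.devCorner_eq_next_glue (T.spin d) (φ * turn⁻¹ * halfTurn)
      rw [next_glue_spin, mul_assoc _ halfTurn halfTurn, halfTurn_mul_self, mul_one,
        inv_mul_cancel_right] at h
      rw [← h]
      exact T.reach_next _ _
    · rw [develop_devCorner]
      simp only [mul_apply]
      rw [← rot_one, rot_vertex_zero, halfTurn_vertex_one]
    · rw [axisForm_inv_turn_vertex_zero]
      exact hpos.ne'
  · rw [spin_iterate_three]
    refine ⟨T.devCorner (next (next (T.glue d))) (φ * halfTurn * turn * turn),
      halfTurn (vertex 2), ?_, rfl, ?_, ?_⟩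
    · rw [devCorner_eq_next_glue]
      exact T.reach_next _ _
    · rw [develop_devCorner]
      simp only [mul_apply]
      rw [← rot_one, rot_vertex_zero, rot_vertex]
      rfl
    · rw [axisForm_halfTurn_vertex_two]
      exact (neg_lt_zero.2 hpos).ne

/-- A blue edge meets red curves at its ends only. -/
theorem eq_corner_of_mem {b r : F × ZMod 6} (hb : ¬ Even b.2) (hr : Even r.2) {x : T.Surface}
    (hxb : x ∈ T.edgeSet b) (hxr : x ∈ T.curveSet r) :
    (x = T.corner b ∨ x = T.corner (next b)) ∧ ∃ n, x = T.corner (T.straight^[n] r) := by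
  obtain ⟨p, hp, rfl⟩ := hxb
  obtain ⟨n, p', hp', hx⟩ := Set.mem_iUnion.1 hxr
  -- Having a representative on a red side is invariant under gluing: a point of a red side that is
  -- glued along a blue side is a vertex, and the neighbouring tile also has a red side there.
  obtain ⟨j, hj, hpj⟩ : ∃ j : ZMod 6, Even j ∧ (p : ℍ) ∈ side j := by
    refine T.of_point_eq (P := fun _ p => ∃ j : ZMod 6, Even j ∧ (p : ℍ) ∈ side j) ?_ hx
      ⟨_, (T.even_straight_iterate r n).2 hr, hp'⟩
    rintro x y ⟨i, i', hg, hx, hy, hd⟩ ⟨j, hj, hxj⟩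
    have hcol := T.glue_colour (x.1, i)
    rw [hg] at hcol
    by_cases hi : Even i
    · exact ⟨i', hcol.2 hi, hy⟩
    · have hij : i ≠ j := fun h => hi (h ▸ hj)
      have hpar := even_next ((y.1, i') : F × ZMod 6)
      have hpar' := even_next ((y.1, i' - 1) : F × ZMod 6)
      simp only [next, sub_add_cancel] at hpar hpar'
      have hi' : ¬ Even i' := fun h => hi (hcol.1 h)
      rcases eq_vertex_of_mem_side hij hx hxj with h | h
      · rw [h, dist_self] at hd
        refine ⟨i' + 1, hpar.2 hi', ?_⟩
        rw [← dist_eq_zero.1 hd.symm]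
        exact vertex_mem_side _
      · rw [h, dist_vertex_add_one] at hd
        have h0 := dist_add_dist_of_mem_side hy
        rw [dist_comm _ (vertex (i' + 1)), ← hd] at h0
        refine ⟨i' - 1, by tauto, ?_⟩
        rw [← dist_eq_zero.1 (show dist (vertex i') (y.2 : ℍ) = 0 by linarith)]
        simpa using vertex_add_one_mem_side (i' - 1)
  have hbj : b.2 ≠ j := fun h => hb (h ▸ hj)
  have hcorner : T.point b.1 p = T.corner b ∨ T.point b.1 p = T.corner (next b) := by
    rcases eq_vertex_of_mem_side hbj hp hpj with h | h
    · exact Or.inl (congrArg (T.point b.1) (Subtype.ext h))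
    · exact Or.inr (congrArg (T.point b.1) (Subtype.ext h))
  refine ⟨hcorner, ?_⟩
  obtain ⟨d, hd⟩ : ∃ d, T.corner d = T.point b.1 p := by
    rcases hcorner with h | h
    · exact ⟨_, h.symm⟩
    · exact ⟨_, h.symm⟩
  obtain ⟨m, i, -, hi⟩ := T.exists_spin_of_corner_eq (hd.trans hx.symm)
  rw [hi, vertex_mem_side_iff] at hp'
  rcases hp' with rfl | h
  · exact ⟨n, hx.symm.trans (congrArg (T.point _) (Subtype.ext hi))⟩
  · refine ⟨n + 1, ?_⟩
    rw [Function.iterate_succ_apply', ← corner_next]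
    exact hx.symm.trans (congrArg (T.point _) (Subtype.ext (hi.trans (congrArg vertex h))))

/-! ### Short closed walks and the two axioms -/

section Regular

variable [Finite F] {k : ℕ}

theorem straight_iterate_period (hreg : T.IsRegular k) (d : F × ZMod 6) : T.straight^[k] d = d := by
  rw [← T.minimalPeriod_straight hreg d, Function.iterate_minimalPeriod]

theorem exists_straight_iterate (hk : 3 ≤ k) (hreg : T.IsRegular k) (d : F × ZMod 6) (n n' : ℕ) :
    ∃ j < k, T.straight^[n'] d = T.straight^[j] (T.straight^[n] d) := by
  -- This is n' - n modulo k.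
  refine ⟨(n' + (k - 1) * n) % k, Nat.mod_lt _ (by omega), ?_⟩
  conv_rhs => rw [← T.minimalPeriod_straight hreg (T.straight^[n] d)]
  rw [Function.iterate_mod_minimalPeriod_eq, T.minimalPeriod_straight hreg,
    ← Function.iterate_add_apply]
  obtain ⟨k', rfl⟩ := Nat.exists_eq_add_of_le' (show 1 ≤ k by omega)
  rw [Nat.add_sub_cancel, show n' + k' * n + n = n' + (k' + 1) * n by ring,
    Function.iterate_add_apply, Function.iterate_mul,
    Function.iterate_fixed (T.straight_iterate_period hreg d)]

theorem straight_iterate_sub (hreg : T.IsRegular k) {d : F × ZMod 6} {j : ℕ} (hj : j ≤ k) :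
    T.straight^[k - j] (T.straight^[j] d) = d := by
  rw [← Function.iterate_add_apply, Nat.sub_add_cancel hj, T.straight_iterate_period hreg]

theorem curveSet_straight_iterate (hk : 3 ≤ k) (hreg : T.IsRegular k) (d : F × ZMod 6) (n : ℕ) :
    T.curveSet (T.straight^[n] d) = T.curveSet d := by
  apply Set.Subset.antisymm
  · refine Set.iUnion_subset fun m => ?_
    rw [← Function.iterate_add_apply]
    exact Set.subset_iUnion (fun n => T.edgeSet (T.straight^[n] d)) (m + n)
  · refine Set.iUnion_subset fun m => ?_
    obtain ⟨j, -, hj⟩ := T.exists_straight_iterate hk hreg d n m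
    rw [hj]
    exact Set.subset_iUnion (fun m => T.edgeSet (T.straight^[m] (T.straight^[n] d))) j

variable [Nonempty F]

/-- An edge and an arc of a perpendicular curve do not form a short bigon. -/
theorem corner_next_ne (hk : 3 ≤ k) (hreg : T.IsRegular k)
    (hsys : MetricSystole.systoles T.Surface = T.curves) {d b : F × ZMod 6}
    (hb : b = T.spin d ∨ b = T.spin^[3] d) {m : ℕ} (hm : 1 + m < k) :
    T.corner (next b) ≠ T.corner (T.straight^[m] d) := by
  intro h
  obtain ⟨e, z, h1, h2, h3, h4⟩ := T.exists_reach_perpendicular hb 1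
  have hreach := h1.symm.trans (T.reach_straight_iterate d 1 m)
  have hm' : (1 + m : ℝ) < k := by exact_mod_cast hm
  have := T.develop_eq_of_reach hk hreg hsys hreach (by nlinarith [sideLength_pos]) (h2.trans h)
  rw [h3, develop_devCorner, one_apply, one_mul] at this
  rw [this, axisForm_translation_pow, axisForm_vertex_zero] at h4
  exact h4 rfl

/-- The same bigon with the perpendicular edge at the far end of the arc; needed because `straight`
follows a curve in one direction only. -/
theorem corner_next_ne' (hk : 3 ≤ k) (hreg : T.IsRegular k)
    (hsys : MetricSystole.systoles T.Surface = T.curves) {d b : F × ZMod 6} {m : ℕ}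
    (hb : b = T.spin (T.straight^[m] d) ∨ b = T.spin^[3] (T.straight^[m] d)) (hm : 1 + m < k) :
    T.corner (next b) ≠ T.corner d := by
  intro h
  obtain ⟨e, z, h1, h2, h3, h4⟩ := T.exists_reach_perpendicular hb (1 * translation ^ m)
  have hreach := (T.reach_straight_iterate d 1 m).trans h1
  have hm' : (1 + m : ℝ) < k := by exact_mod_cast hm
  have := T.develop_eq_of_reach hk hreg hsys hreach (by nlinarith [sideLength_pos]) (h2.trans h).symm
  rw [h3, develop_devCorner, one_apply, one_mul] at this
  rw [← axisForm_translation_pow m, ← this, axisForm_vertex_zero] at h4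
  exact h4 rfl

/-- The two ends of a blue edge do not lie on the same red curve. -/
theorem corner_ne_of_blue (hk : 3 ≤ k) (hreg : T.IsRegular k)
    (hsys : MetricSystole.systoles T.Surface = T.curves) {b r : F × ZMod 6} (hb : ¬ Even b.2)
    (hr : Even r.2) {n n' : ℕ} (h1 : T.corner b = T.corner (T.straight^[n] r)) :
    T.corner (next b) ≠ T.corner (T.straight^[n'] r) := by
  have hb' := T.eq_spin_of_corner_eq h1.symm ((T.even_straight_iterate r n).2 hr) hb
  obtain ⟨j, hj, hj'⟩ := T.exists_straight_iterate hk hreg r n n'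
  -- If the forward arc is too long, then j = k - 1 and the other arc is a single edge; the bigon
  -- then has 2 < k edges.
  rcases Nat.lt_or_ge (1 + j) k with h | h
  · rw [hj']
    exact T.corner_next_ne hk hreg hsys hb' h
  · have hback : T.straight^[1] (T.straight^[n'] r) = T.straight^[n] r := by
      rw [hj', show 1 = k - j by omega, T.straight_iterate_sub hreg hj.le]
    rw [← hback] at hb'
    exact T.corner_next_ne' hk hreg hsys hb' (by omega)

theorem ax4_of_systoles (hk : 3 ≤ k) (hreg : T.IsRegular k)
    (hsys : MetricSystole.systoles T.Surface = T.curves) : T.AX4 := by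
  intro b r hb hr x hx y hy
  obtain ⟨hx1, n, hxn⟩ := T.eq_corner_of_mem hb hr hx.1 hx.2
  obtain ⟨hy1, n', hyn⟩ := T.eq_corner_of_mem hb hr hy.1 hy.2
  rcases hx1 with hx1 | hx1 <;> rcases hy1 with hy1 | hy1
  · rw [hx1, hy1]
  · exact absurd (hy1.symm.trans hyn)
      (T.corner_ne_of_blue hk hreg hsys hb hr (hx1.symm.trans hxn))
  · exact absurd (hx1.symm.trans hxn)
      (T.corner_ne_of_blue hk hreg hsys hb hr (hy1.symm.trans hyn))
  · rw [hx1, hy1]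

/-- A rectangle one of whose sides is a single edge is not short. -/
theorem not_thin_rectangle (hk : 3 ≤ k) (hreg : T.IsRegular k)
    (hsys : MetricSystole.systoles T.Surface = T.curves) {d e : F × ZMod 6} {m : ℕ} (hm : 1 ≤ m)
    (hmk : m ≤ k) (h : next (next (T.straight d)) = T.straight e) :
    next (next (T.straight^[m] e)) ≠ T.straight d := by
  intro h'
  obtain rfl | ⟨c, rfl⟩ : m = 1 ∨ ∃ c, m = c + 2 := by
    rcases hm.eq_or_lt with h | h
    · exact Or.inl h.symm
    · exact Or.inr ⟨m - 2, by omega⟩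
  -- Four steps around a hexagon do not lead back to the same side.
  · rw [Function.iterate_one, ← h] at h'
    have := congrArg Prod.snd h'
    simp only [next, add_assoc] at this
    exact absurd (add_eq_left.1 this) (by decide)
  -- The second red curve passes through two sides of one tile, and the blue side between them
  -- closes an arc of c edges.
  · refine T.corner_next_ne hk hreg hsys (d := T.straight^[2] e) (b := next (T.straight e)) (m := c)
      (Or.inl ?_) (by omega) ?_
    · rw [Function.iterate_succ_apply', Function.iterate_one, spin_straight]
    · rw [← Function.iterate_add_apply]
      congr 1
      refine next_injective (next_injective ?_)
      rw [h', ← h]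
      simp only [next, add_assoc]
      exact Prod.ext rfl (add_eq_left.2 (by decide))

/-- A rectangle with sides on two red curves and two blue edges, lying on the same side of each of
these, is not short. -/
theorem not_rectangle (hk : 3 ≤ k) (hreg : T.IsRegular k)
    (hsys : MetricSystole.systoles T.Surface = T.curves) {d e : F × ZMod 6} {m m' : ℕ} (hm : 1 ≤ m)
    (hm' : 1 ≤ m') (hmm : m + m' ≤ k) (h : next (next (T.straight^[m] d)) = T.straight e) :
    next (next (T.straight^[m'] e)) ≠ T.straight d := by
  intro h'
  rcases hm.eq_or_lt with rfl | hm
  · exact T.not_thin_rectangle hk hreg hsys hm' (by omega) h h'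
  rcases hm'.eq_or_lt with rfl | hm'
  · exact T.not_thin_rectangle hk hreg hsys hm.le (by omega) h' h
  obtain ⟨a, rfl⟩ := Nat.exists_eq_add_of_le' hm
  obtain ⟨c, rfl⟩ := Nat.exists_eq_add_of_le' hm'
  rw [Nat.succ_eq_add_one, one_add_one_eq_two] at *
  -- Each diagonal replaces the last red edge of one arc, a blue edge and the first red edge of the
  -- other arc, so that a and c red edges remain. The total is less than (a + c + 4)ℓ ≤ kℓ.
  obtain ⟨s, hs, r2⟩ := T.reach_diagonal (T.straight^[a + 2] d) (1 * translation ^ a)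
  obtain ⟨s', hs', r4⟩ := T.reach_diagonal (T.straight^[c + 2] e)
    (1 * translation ^ a * rot 2 * translation * translation ^ c)
  have r1 := T.reach_straight_iterate (T.straight (T.straight d)) 1 a
  have r3 := T.reach_straight_iterate (T.straight (T.straight e))
    (1 * translation ^ a * rot 2 * translation) c
  rw [h, devCorner_next] at r2
  rw [h', devCorner_next] at r4
  simp only [← Function.iterate_succ_apply] at r1 r3
  have hreach := ((r1.trans r2).trans r3).trans r4
  have hdev := T.develop_eq_of_reach hk hreg hsys hreach (by
    have : ((a + 2 + (c + 2) : ℕ) : ℝ) ≤ k := by exact_mod_cast hmm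
    push_cast at this
    nlinarith [sideLength_pos]) rfl
  rw [develop_devCorner, develop_devCorner] at hdev
  simp only [mul_apply, one_apply] at hdev
  -- The form of the first line is invariant under the translations along it. Closing up would thus
  -- place a translate of vertex 3 along the second line on the first line.
  have hax := axisForm_translation_pow a
    (rot 2 (translation ((translation ^ c) (rot 2 (translation (vertex 0))))))
  rw [← hdev, axisForm_vertex_zero, translation_vertex_zero, rot_vertex] at hax
  have hpos := sideForm_translation_pow_pos (c + 1)
  rw [pow_succ', mul_apply, sideForm] at hpos
  have e2 : ∀ z, rot 2 z = turn (turn z) := by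
    intro z
    rw [← mul_apply, ← rot_one, ← rot_add]
    rfl
  rw [e2] at hax
  exact hpos.ne hax

theorem ax5_of_systoles (hk : 3 ≤ k) (hreg : T.IsRegular k)
    (hsys : MetricSystole.systoles T.Surface = T.curves) : T.AX5 := by
  rintro b b' - - hne r r' - - ⟨⟨n₁, h₁⟩, ⟨n₂, h₂⟩⟩ ⟨⟨n₃, h₃⟩, ⟨n₄, h₄⟩⟩
  by_contra hcurve
  have hdis : ∀ n n', T.straight^[n] r ≠ T.straight^[n'] r' := by
    intro n n' h
    refine hcurve ?_
    rw [← T.curveSet_straight_iterate hk hreg r n, h, T.curveSet_straight_iterate hk hreg]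
  -- A common blue edge is seen from its two different tiles; otherwise the red sides preceding it
  -- would coincide, and with them the curves. Hence the two red curves are run through in opposite
  -- directions.
  have opposite : ∀ n n', T.edge (next (T.straight^[n] r)) = T.edge (next (T.straight^[n'] r')) →
      next (T.straight^[n] r) = T.glue (next (T.straight^[n'] r')) := by
    intro n n' h
    rcases T.edge_eq_iff.1 h with h | h
    · exact absurd (next_injective h) (hdis n n')
    · exact h
  have g1 := opposite _ _ (h₁.trans h₃.symm)
  have g2 := opposite _ _ (h₂.trans h₄.symm)
  obtain ⟨m, hm, hm'⟩ := T.exists_straight_iterate hk hreg r n₁ n₂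
  obtain ⟨l, hl, hl'⟩ := T.exists_straight_iterate hk hreg r' n₄ n₃
  have hne' : T.straight^[n₁] r ≠ T.straight^[n₂] r := by
    intro h
    rw [← h₁, ← h₂, h] at hne
    exact hne rfl
  have hm0 : m ≠ 0 := by
    rintro rfl
    exact hne' hm'.symm
  have hl0 : l ≠ 0 := by
    rintro rfl
    rw [hl', Function.iterate_zero_apply, ← g2] at g1
    exact hne' (next_injective g1)
  have g1' : T.glue (next (T.straight^[n₁] r)) = next (T.straight^[n₃] r') := by
    rw [g1, glue_glue]
  have g2' : T.glue (next (T.straight^[n₂] r)) = next (T.straight^[n₄] r') := by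
    rw [g2, glue_glue]
  -- If the two arcs are too long together, the complementary arcs have 2k - (m + l) < k edges.
  rcases Nat.lt_or_ge k (m + l) with hlt | hle
  · have b1 : T.straight^[k - m] (T.straight^[n₂] r) = T.straight^[n₁] r := by
      rw [hm', T.straight_iterate_sub hreg hm.le]
    have b2 : T.straight^[k - l] (T.straight^[n₃] r') = T.straight^[n₄] r' := by
      rw [hl', T.straight_iterate_sub hreg hl.le]
    refine T.not_rectangle hk hreg hsys (d := T.straight^[n₂] r) (e := T.straight^[n₃] r')
      (m := k - m) (m' := k - l) (by omega) (by omega) (by omega) ?_ ?_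
    · rw [b1, g1, straight]
    · rw [b2, ← g2', straight]
  · refine T.not_rectangle hk hreg hsys (d := T.straight^[n₁] r) (e := T.straight^[n₄] r')
      (m := m) (m' := l) (by omega) (by omega) hle ?_ ?_
    · rw [← hm', g2, straight]
    · rw [← hl', ← g1', straight]

end Regular

end HexTessellation

theorem mainTheorem6 {F : Type*} [Finite F] [Nonempty F] (k : ℕ) (hk : 3 ≤ k)
    (T : HexTessellation F) (hreg : T.IsRegular k)
    (hsys : MetricSystole.systoles T.Surface = T.curves) :
    T.AX4 ∧ T.AX5 := by
  exact ⟨T.ax4_of_systoles hk hreg hsys, T.ax5_of_systoles hk hreg hsys⟩
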